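/- **Setting.** Let $M\ge 2$ be the number of hypotheses, $\mathcal A$ a finite set of actions, $\mathcal P(\mathcal A)$ the set of probability distributions on $\mathcal A$, and let $q_i^a$ ($1\le i\le M$, $a\in\mathcal A$) be probability densities on a measurable space $\mathcal X$ with respect to a common reference measure $\mu$. Under hypothesis $i$, the observation $X_n$ given the action $A_n=a$ has density $q_i^a$ and is conditionally independent of the past. Let $D(q_i^a\Vert q_j^a)$ denote relative entropy, put $\mathcal A_{ij}=\{a\in\mathcal A : D(q_i^a\Vert q_j^a)>0\}$, $$D_i=\max_{\lambda\in\mathcal P(\mathcal A)}\ \min_{j\ne i}\ \sum_{a\in\mathcal A}\lambda(a)\,D(q_i^a\Vert q_j^a),$$ and let $\lambda_i\in\mathcal P(\mathcal A)$ be any maximizer. Assume (I) $E_i\big[(\log \tfrac{q_i^a(X)}{q_j^a(X)})^2\big]<\infty$ for all $i,j,a$, where $X$ has density $q_i^a$ (and $\log(c/0)=\infty$ for $c>0$); (IIb) $\beta:=\min_{i\ne j,\,k}\ \sum_{a\in\mathcal A_{ij}}\lambda_k(a)>0$. **Sluggish Procedure A.** Fix $\eta\in(0,1]$ and $L>0$.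 Let $Z_i(n)$ be the log-likelihood of hypothesis $i$ given the first $n$ actions and observations, so that $Z_{ij}(n)=Z_i(n)-Z_j(n)=\sum_{l=1}^n\log\frac{q_i^{A_l}(X_l)}{q_j^{A_l}(X_l)}$. The first action $A_1$ is drawn from an arbitrary distribution on $\mathcal A$. At time $n\ge1$, after observing $X_n$, let $\theta(n)$ be a maximizer of $i\mapsto Z_i(n)$, ties being resolved uniformly at random. If $Z_{\theta(n),j}(n)\ge\log((M-1)L)$ for all $j\ne\theta(n)$, the procedure stops (and declares hypothesis $\theta(n)$). Otherwise an independent Bernoulli$(\eta)$ variable $U_{n+1}$ is generated; if $U_{n+1}=0$ then $A_{n+1}=A_n$, and if $U_{n+1}=1$ then $A_{n+1}$ is drawn from $\lambda_{\theta(n)}$. Let $\tau(\pi_{SA}(L,\eta))$ be the time $n$ at which the procedure stops. **Theorem.** Assume (I) and (IIb), and fix $\eta\in(0,1]$. Then for each $i$, with $E_i$ the expectation under hypothesis $i$, the following limit exists and $$\lim_{L\to\infty}\frac{E_i\big[\tau(\pi_{SA}(L,\eta))\big]}{\log L}\ \le\ \frac1{D_i}.$$ -/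

import Mathlib

open MeasureTheory Filter Topology
open scoped ENNReal

namespace ASHT

/-- The observation model: for each of the `M` hypotheses `i` and each action `a`, a probability
density `q i a` on the observation space `𝒳` with respect to a common reference measure `μ`. -/
structure Model (M : ℕ) (𝒜 𝒳 : Type*) [MeasurableSpace 𝒳] where
  /-- reference measure -/
  μ : Measure 𝒳
  /-- `q i a` is the density of an observation under action `a` when hypothesis `i` is true -/
  q : Fin M → 𝒜 → 𝒳 → ℝ
  measurable_q : ∀ i a, Measurable (q i a)
  q_nonneg : ∀ i a x, 0 ≤ q i a x
  lintegral_q : ∀ i a, ∫⁻ x, ENNReal.ofReal (q i a x) ∂μ = 1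

variable {M : ℕ} {𝒜 𝒳 : Type*} [MeasurableSpace 𝒳]

namespace Model

/-- The law of one observation under hypothesis `i` and action `a`. -/
noncomputable def obs (m : Model M 𝒜 𝒳) (i : Fin M) (a : 𝒜) : Measure 𝒳 :=
  m.μ.withDensity fun x => ENNReal.ofReal (m.q i a x)

instance (m : Model M 𝒜 𝒳) (i : Fin M) (a : 𝒜) : IsProbabilityMeasure (m.obs i a) :=
  ⟨by rw [obs, withDensity_apply _ MeasurableSet.univ, Measure.restrict_univ, m.lintegral_q]⟩

/-- The relative entropy `D(q_i^a ‖ q_j^a)`. -/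
noncomputable def relEnt (m : Model M 𝒜 𝒳) (i j : Fin M) (a : 𝒜) : ℝ≥0∞ :=
  InformationTheory.klDiv (m.obs i a) (m.obs j a)

/-- Assumption (I): `E_i[(log (q_i^a(X) / q_j^a(X)))²] < ∞` for all `i, j, a`. In the convention
`log (c / 0) = ∞` for `c > 0`, finiteness includes that `q_j^a > 0` almost surely under `q_i^a`;
since `Real.log` takes the value `0` there instead, this is the explicit first conjunct. -/
def AssumptionI (m : Model M 𝒜 𝒳) : Prop :=
  ∀ i j a, (∀ᵐ x ∂(m.obs i a), 0 < m.q j a x) ∧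
    Integrable (fun x => Real.log (m.q i a x / m.q j a x) ^ 2) (m.obs i a)

variable [Fintype 𝒜]

/-- `min_{j ≠ i} ∑ₐ λ(a) D(q_i^a ‖ q_j^a)` for a mixed action `λ`. -/
noncomputable def guard (m : Model M 𝒜 𝒳) (i : Fin M) (lam : PMF 𝒜) : ℝ≥0∞ :=
  ⨅ (j : Fin M) (_ : j ≠ i), ∑ a, lam a * m.relEnt i j a

/-- `D_i = max_λ min_{j ≠ i} ∑ₐ λ(a) D(q_i^a ‖ q_j^a)`. -/
noncomputable def rate (m : Model M 𝒜 𝒳) (i : Fin M) : ℝ≥0∞ :=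
  ⨆ lam : PMF 𝒜, m.guard i lam

/-- `lam i` is, for every hypothesis `i`, one of the mixed actions attaining the maximum `D_i`. -/
def IsOptimal (m : Model M 𝒜 𝒳) (lam : Fin M → PMF 𝒜) : Prop :=
  ∀ i, ∀ lam' : PMF 𝒜, m.guard i lam' ≤ m.guard i (lam i)

open Classical in
/-- `β = min_{i ≠ j, k} ∑_{a ∈ 𝒜_{ij}} λ_k(a)`, where `𝒜_{ij} = {a | D(q_i^a ‖ q_j^a) > 0}`. -/
noncomputable def beta (m : Model M 𝒜 𝒳) (lam : Fin M → PMF 𝒜) : ℝ≥0∞ :=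
  ⨅ (i : Fin M) (j : Fin M) (_ : i ≠ j) (k : Fin M),
    ∑ a ∈ Finset.univ.filter (fun a => 0 < m.relEnt i j a), lam k a

/-- Assumption (IIb): `β > 0`. -/
def AssumptionIIb (m : Model M 𝒜 𝒳) (lam : Fin M → PMF 𝒜) : Prop :=
  0 < m.beta lam

end Model

/-- The randomness that is freshly drawn at one time instant:
* the switching bit `U`;
* for each hypothesis `k`, an action proposed in case `k` is the current leader;
* for each action `a`, the observation that is seen in case `a` is the action taken;
* for each nonempty set `S` of hypotheses, the tie-break used in case `S` is the set of maximizers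
  of the log-likelihood. -/
abbrev Noise (M : ℕ) (𝒜 𝒳 : Type*) : Type _ :=
  Bool × (Fin M → 𝒜) × (𝒜 → 𝒳) × ({S : Finset (Fin M) // S.Nonempty} → Fin M)

/-- Sample space: the first action and the fresh randomness at the times `1, 2, 3, …`
(the entry with index `n` belongs to time `n + 1`). -/
abbrev Sample (M : ℕ) (𝒜 𝒳 : Type*) : Type _ := 𝒜 × (ℕ → Noise M 𝒜 𝒳)

open Classical in
/-- The set of maximizers of `z`. -/
noncomputable def argmax (z : Fin M → ℝ) : Finset (Fin M) :=
  Finset.univ.filter fun i => ∀ j, z j ≤ z i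

theorem argmax_nonempty [NeZero M] (z : Fin M → ℝ) : (argmax z).Nonempty := by
  obtain ⟨i, hi⟩ := Finite.exists_max z
  exact ⟨i, by simp [argmax, hi]⟩

/-- What is relevant at a time `n` about the run: the action `A_n`, the observation `X_n`, the
log-likelihoods `Z(n)` and the leading hypothesis `θ(n)`. -/
structure State (M : ℕ) (𝒜 𝒳 : Type*) where
  /-- the action `A_n` -/
  action : 𝒜
  /-- the observation `X_n` -/
  observation : 𝒳
  /-- the log-likelihoods `Z_1(n), …, Z_M(n)` -/
  Z : Fin M → ℝ
  /-- the hypothesis `θ(n)` with the largest log-likelihood -/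
  leader : Fin M

namespace Model

/-- The law under hypothesis `i` of the randomness drawn at one time instant. All components are
independent; the bit is Bernoulli(`η`), the action proposed for the leader `k` has the
distribution `λ_k`, the observation for the action `a` has the density `q_i^a`, and the tie-break
in `S` is uniform on `S`. -/
noncomputable def noiseLaw [Fintype 𝒜] [MeasurableSpace 𝒜] (m : Model M 𝒜 𝒳)
    (lam : Fin M → PMF 𝒜) (η : unitInterval) (i : Fin M) : Measure (Noise M 𝒜 𝒳) :=
  (ProbabilityTheory.bernoulliMeasure true false η).prod
    ((Measure.pi fun k => (lam k).toMeasure).prod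
      ((Measure.pi fun a => m.obs i a).prod
        (Measure.pi fun S : {S : Finset (Fin M) // S.Nonempty} =>
          (PMF.uniformOfFinset S.1 S.2).toMeasure)))

/-- The probability measure `P_i`: the first action has the distribution `ν`, and independently of
it the randomness at the successive time instants is i.i.d. with law `noiseLaw`. -/
noncomputable def law [Fintype 𝒜] [MeasurableSpace 𝒜] (m : Model M 𝒜 𝒳)
    (lam : Fin M → PMF 𝒜) (η : unitInterval) (ν : PMF 𝒜) (i : Fin M) :
    Measure (Sample M 𝒜 𝒳) :=
  ν.toMeasure.prod (Measure.infinitePi fun _ : ℕ => m.noiseLaw lam η i)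

instance [Fintype 𝒜] [MeasurableSpace 𝒜] (m : Model M 𝒜 𝒳)
    (lam : Fin M → PMF 𝒜) (η : unitInterval) (i : Fin M) :
    IsProbabilityMeasure (m.noiseLaw lam η i) := by
  unfold noiseLaw; infer_instance

instance [Fintype 𝒜] [MeasurableSpace 𝒜] (m : Model M 𝒜 𝒳)
    (lam : Fin M → PMF 𝒜) (η : unitInterval) (ν : PMF 𝒜) (i : Fin M) :
    IsProbabilityMeasure (m.law lam η ν i) := by
  unfold law; infer_instance

variable [NeZero M]

/-- Taking action `a` when the log-likelihoods are `z`: the observation under `a` is received, the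
log-likelihoods are updated (up to the contribution of the sampling probabilities of the actions,
which is the same for all hypotheses), and the leader is determined, ties being resolved by the
tie-break variable. -/
noncomputable def observe (m : Model M 𝒜 𝒳) (z : Fin M → ℝ) (a : 𝒜) (w : Noise M 𝒜 𝒳) :
    State M 𝒜 𝒳 :=
  let x := w.2.2.1 a
  let z' := fun k => z k + Real.log (m.q k a x)
  { action := a
    observation := x
    Z := z'
    leader := w.2.2.2 ⟨argmax z', argmax_nonempty z'⟩ }

/-- The run of Sluggish Procedure A without stopping; `m.run ω n` is the state at time `n + 1`.
If `U = 1`, the next action is the one generated according to `λ_θ` for the leader `θ`; if `U = 0`,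
the current action is continued. -/
noncomputable def run (m : Model M 𝒜 𝒳) (ω : Sample M 𝒜 𝒳) : ℕ → State M 𝒜 𝒳
  | 0 => m.observe (fun _ => 0) ω.1 (ω.2 0)
  | n + 1 =>
    let s := m.run ω n
    let w := ω.2 (n + 1)
    m.observe s.Z (if w.1 then w.2.1 s.leader else s.action) w

/-- Sluggish Procedure A with parameter `L` retires in the state `s`:
`Z_θ - Z_j ≥ log ((M - 1) L)` for the leader `θ` and all `j ≠ θ`. -/
def _root_.ASHT.State.Retires (s : State M 𝒜 𝒳) (L : ℝ) : Prop :=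
  ∀ j, j ≠ s.leader → Real.log (((M : ℝ) - 1) * L) ≤ s.Z s.leader - s.Z j

/-- The time `τ` at which Sluggish Procedure A with parameter `L` retires (`∞` if it never does). -/
noncomputable def stoppingTime (m : Model M 𝒜 𝒳) (L : ℝ) (ω : Sample M 𝒜 𝒳) : ℕ∞ :=
  ⨅ (n : ℕ) (_ : (m.run ω n).Retires L), ((n + 1 : ℕ) : ℕ∞)

/-- `E_i[τ]`, a value in `[0, ∞]`. -/
noncomputable def expectedStoppingTime [Fintype 𝒜] [MeasurableSpace 𝒜] (m : Model M 𝒜 𝒳)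
    (lam : Fin M → PMF 𝒜) (η : unitInterval) (ν : PMF 𝒜) (L : ℝ) (i : Fin M) : ℝ≥0∞ :=
  ∫⁻ ω, ((m.stoppingTime L ω : ℕ∞) : ℝ≥0∞) ∂(m.law lam η ν i)

end Model

end ASHT

/-! Fix the true hypothesis `i`. Since all randomness of a time instant is drawn afresh, whatever
the state of the run, the noise is i.i.d. and the run is adapted to its canonical filtration.

Exponential control. The square root of the likelihood ratio of `j` against `i` has conditional mean
at most 1 after any action, and below 1 after an action that separates `i` from `j`. By (IIb) every
`λ_k` charges such an action, and a new action is drawn with probability `η > 0`. Hence, whoever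
leads, each step contracts the mean by a factor at most `r < 1`, so that `E_i[exp(-Z_ij/2)]` decays
geometrically (`lintegral_exp_gap_le`). By Markov's inequality, the expected number of times at
which some `Z_ij(n)` lies below `κ n` is finite (`exists_linear_lower_bound`). In particular the
leader is eventually `i`.

Law of large numbers. Given the past, the next action is `a` with probability `η λ_θ(a) + (1-η) 1{A
= a}`, where `A` is the current action. Up to a martingale that is negligible on average, the
frequency `f` of `a` therefore satisfies `f ≈ η λ_i(a) + (1-η) f`, whence `f → λ_i(a)` for every `η
> 0`: sluggishness costs nothing to first order. The same martingale argument with log-likelihood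
ratios gives `Z_ij(n)/n → ∑ₐ λ_i(a) D(q_i^a ‖ q_j^a)` (`ae_tendsto_gap_div`), and the smallest of
these limits is `D_i`.

Inversion. Retirement occurs when the smallest gap passes `log L + log (M-1)`, so `τ / log L →
1/D_i` almost surely. The number of times below the line `κ n` dominates `τ / log L` up to a
constant, and dominated convergence passes the limit to expectations. The limit is thus exactly
`1/D_i`. -/

namespace ASHT

/-! ### Past and next coordinate of an i.i.d. sequence -/

section IndependentSequence

variable {E : Type*} [MeasurableSpace E]

/-- The first `n + 1` coordinates of an i.i.d. sequence are independent of the next one. -/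
theorem indep_piLE_eval_succ (κ : Measure E) [IsProbabilityMeasure κ] (n : ℕ) :
    ProbabilityTheory.Indep (Filtration.piLE (X := fun _ : ℕ => E) n)
      (MeasurableSpace.comap (fun ω : ℕ → E => ω (n + 1)) inferInstance)
      (Measure.infinitePi fun _ : ℕ => κ) := by
  have h := (ProbabilityTheory.iIndepFun_infinitePi (P := fun _ : ℕ => κ) (X := fun _ x => x)
    (fun _ => measurable_id)).iIndep
  have h2 := ProbabilityTheory.indep_iSup_of_disjoint
    (fun i => (measurable_pi_apply i).comap_le) h
    (S := Set.Iic n) (T := {n + 1}) (by simp)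
  refine ProbabilityTheory.indep_of_indep_of_le_left
    (ProbabilityTheory.indep_of_indep_of_le_right h2 ?_) ?_
  · exact le_iSup₂_of_le (n + 1) rfl le_rfl
  · change MeasurableSpace.comap _ (⨆ _, _) ≤ _
    rw [MeasurableSpace.comap_iSup]
    refine iSup_le fun i => ?_
    rw [MeasurableSpace.comap_comp]
    exact le_iSup₂_of_le i.1 i.2 le_rfl

theorem measurable_of_piLE {F : Type*} [MeasurableSpace F] {n : ℕ} {g : (ℕ → E) → F}
    (hg : Measurable[Filtration.piLE (X := fun _ : ℕ => E) n] g) : Measurable g :=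
  hg.mono (Filtration.le _ n) le_rfl

theorem measurable_piLE_eval {n k : ℕ} (h : k ≤ n) :
    Measurable[Filtration.piLE (X := fun _ : ℕ => E) n] (fun ω : ℕ → E => ω k) := by
  have : (fun ω : ℕ → E => ω k) =
      (fun x : (i : Set.Iic n) → E => x ⟨k, h⟩) ∘ (Preorder.restrictLe n) := rfl
  rw [this]
  exact (measurable_pi_apply _).comp (comap_measurable _)

theorem indepFun_of_piLE (κ : Measure E) [IsProbabilityMeasure κ] {n : ℕ} {F G : Type*}
    [MeasurableSpace F] [MeasurableSpace G] {g : (ℕ → E) → F} {f : E → G}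
    (hg : Measurable[Filtration.piLE (X := fun _ : ℕ => E) n] g) (hf : Measurable f) :
    ProbabilityTheory.IndepFun g (fun ω => f (ω (n + 1))) (Measure.infinitePi fun _ : ℕ => κ) := by
  rw [ProbabilityTheory.IndepFun_iff_Indep]
  refine ProbabilityTheory.indep_of_indep_of_le_left
    (ProbabilityTheory.indep_of_indep_of_le_right (indep_piLE_eval_succ κ n) ?_) hg.comap_le
  exact (hf.comp (comap_measurable _)).comap_le

theorem lintegral_eval_infinitePi (κ : Measure E) [IsProbabilityMeasure κ] {f : E → ℝ≥0∞}
    (hf : Measurable f) (n : ℕ) :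
    ∫⁻ ω, f (ω n) ∂(Measure.infinitePi fun _ : ℕ => κ) = ∫⁻ x, f x ∂κ :=
  (measurePreserving_eval_infinitePi (fun _ : ℕ => κ) n).lintegral_comp hf

theorem lintegral_mul_eval_succ (κ : Measure E) [IsProbabilityMeasure κ] {n : ℕ}
    {g : (ℕ → E) → ℝ≥0∞} {f : E → ℝ≥0∞}
    (hg : Measurable[Filtration.piLE (X := fun _ : ℕ => E) n] g) (hf : Measurable f) :
    ∫⁻ ω, g ω * f (ω (n + 1)) ∂(Measure.infinitePi fun _ : ℕ => κ) =
      (∫⁻ ω, g ω ∂(Measure.infinitePi fun _ : ℕ => κ)) * ∫⁻ x, f x ∂κ := by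
  rw [← lintegral_eval_infinitePi κ hf (n + 1)]
  exact ProbabilityTheory.lintegral_mul_eq_lintegral_mul_lintegral_of_indepFun
    (measurable_of_piLE hg) (hf.comp (measurable_pi_apply _)) (indepFun_of_piLE κ hg hf)

/-- This replaces conditioning on the past: on each event `s = t` the integrand is a past quantity
times a fixed function of the fresh coordinate, so independence factorizes the integral. Finiteness
of `S` makes the decomposition a finite sum. -/
theorem lintegral_mul_eval_succ_le (κ : Measure E) [IsProbabilityMeasure κ] {n : ℕ} {S : Type*}
    [Finite S] [MeasurableSpace S] [MeasurableSingletonClass S] {s : (ℕ → E) → S}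
    {X : (ℕ → E) → ℝ≥0∞} {G : S → E → ℝ≥0∞} {r : ℝ≥0∞}
    (hs : Measurable[Filtration.piLE (X := fun _ : ℕ => E) n] s)
    (hX : Measurable[Filtration.piLE (X := fun _ : ℕ => E) n] X)
    (hG : ∀ t, Measurable (G t)) (hr : ∀ t, ∫⁻ x, G t x ∂κ ≤ r) :
    ∫⁻ ω, X ω * G (s ω) (ω (n + 1)) ∂(Measure.infinitePi fun _ : ℕ => κ) ≤
      (∫⁻ ω, X ω ∂(Measure.infinitePi fun _ : ℕ => κ)) * r := by
  classical
  have := Fintype.ofFinite S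
  set I : S → (ℕ → E) → ℝ≥0∞ := fun t ω => if s ω = t then X ω else 0 with hI
  have hIm : ∀ t, Measurable[Filtration.piLE (X := fun _ : ℕ => E) n] (I t) := fun t =>
    Measurable.ite (hs (measurableSet_singleton t)) hX measurable_const
  have h1 : ∀ ω, X ω * G (s ω) (ω (n + 1)) = ∑ t, I t ω * G t (ω (n + 1)) := by
    intro ω
    simp [hI]
  have h2 : ∀ ω, X ω = ∑ t, I t ω := by
    intro ω
    simp [hI]
  calc ∫⁻ ω, X ω * G (s ω) (ω (n + 1)) ∂(Measure.infinitePi fun _ : ℕ => κ)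
      = ∑ t, ∫⁻ ω, I t ω * G t (ω (n + 1)) ∂(Measure.infinitePi fun _ : ℕ => κ) := by
        simp_rw [h1]
        exact lintegral_finsetSum _ fun t _ => (measurable_of_piLE (hIm t)).mul
          ((hG t).comp (measurable_pi_apply (n + 1)))
    _ = ∑ t, (∫⁻ ω, I t ω ∂(Measure.infinitePi fun _ : ℕ => κ)) * ∫⁻ x, G t x ∂κ :=
        Finset.sum_congr rfl fun t _ => lintegral_mul_eval_succ κ (hIm t) (hG t)
    _ ≤ ∑ t, (∫⁻ ω, I t ω ∂(Measure.infinitePi fun _ : ℕ => κ)) * r := by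
        gcongr with t
        exact hr t
    _ = (∫⁻ ω, X ω ∂(Measure.infinitePi fun _ : ℕ => κ)) * r := by
        rw [← Finset.sum_mul, ← lintegral_finsetSum _ fun t _ => measurable_of_piLE (hIm t)]
        simp_rw [h2]

end IndependentSequence

/-! ### Strong law for predictable transforms -/

/-- A special case of Kronecker's lemma. -/
theorem tendsto_average_of_tendsto_sum_div {x : ℕ → ℝ} {s : ℝ}
    (h : Tendsto (fun n => ∑ l ∈ Finset.range n, x l / (l + 1)) atTop (𝓝 s)) :
    Tendsto (fun n : ℕ => (n : ℝ)⁻¹ * ∑ l ∈ Finset.range n, x l) atTop (𝓝 0) := by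
  set S : ℕ → ℝ := fun n => ∑ l ∈ Finset.range n, x l / (l + 1) with hS
  -- Summation by parts. After division by `n`, the right side is `S n` minus the Cesàro mean of
  -- `S`, and both tend to `s`.
  have h1 : ∀ n : ℕ, ∑ l ∈ Finset.range n, x l = n * S n - ∑ l ∈ Finset.range n, S l := by
    intro n
    induction n with
    | zero => simp
    | succ n ih =>
      have h2 : S (n + 1) = S n + x n / (n + 1) := Finset.sum_range_succ _ _
      have h3 : x n = (n + 1) * (x n / (n + 1)) := by field_simp
      rw [Finset.sum_range_succ, Finset.sum_range_succ, ih, h2]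
      push_cast
      linear_combination h3
  have h2 := h.sub h.cesaro
  rw [sub_self] at h2
  refine h2.congr' ?_
  filter_upwards [eventually_gt_atTop 0] with n hn
  have : (n : ℝ) ≠ 0 := by positivity
  rw [h1]
  field_simp

section PredictableTransform

variable {E : Type*} [MeasurableSpace E]

/-- Strong law of large numbers for a bounded predictable transform of a centred,
square-integrable i.i.d. sequence. -/
theorem ae_tendsto_average_predictable_mul (κ : Measure E) [IsProbabilityMeasure κ]
    {b : ℕ → (ℕ → E) → ℝ} {f : E → ℝ}
    (hb : ∀ n, Measurable[Filtration.piLE (X := fun _ : ℕ => E) n] (b n))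
    (hb1 : ∀ n ω, |b n ω| ≤ 1) (hfm : Measurable f) (hf2 : MemLp f 2 κ) (hf0 : ∫ x, f x ∂κ = 0) :
    ∀ᵐ ω ∂(Measure.infinitePi fun _ : ℕ => κ),
      Tendsto (fun n : ℕ => (n : ℝ)⁻¹ * ∑ l ∈ Finset.range n, b l ω * f (ω (l + 1)))
        atTop (𝓝 0) := by
  set P := Measure.infinitePi fun _ : ℕ => κ with hP
  set 𝓕 := Filtration.piLE (ι := ℕ) (X := fun _ : ℕ => E) with h𝓕
  set Y : ℕ → (ℕ → E) → ℝ := fun n ω => f (ω (n + 1)) with hY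
  -- The weights `1/(l+1)` are square-summable, which makes this martingale bounded in L²;
  -- Kronecker's lemma then removes them.
  set M : ℕ → (ℕ → E) → ℝ :=
    fun n ω => ∑ l ∈ Finset.range n, b l ω * Y l ω / (l + 1) with hM
  have hYm : ∀ n, Measurable[𝓕 (n + 1)] (Y n) := fun n => hfm.comp (measurable_piLE_eval le_rfl)
  have hmp : ∀ n, MeasurePreserving (fun ω : ℕ → E => ω n) P κ :=
    measurePreserving_eval_infinitePi (fun _ : ℕ => κ)
  have hY2 : ∀ n, MemLp (Y n) 2 P := fun n => hf2.comp_measurePreserving (hmp (n + 1))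
  have hY0 : ∀ n, ∫ ω, Y n ω ∂P = 0 := by
    intro n
    rw [← hf0, ← (hmp (n + 1)).map_eq, integral_map (hmp (n + 1)).measurable.aemeasurable
      hfm.aestronglyMeasurable]
  have hYsq : ∀ n, ∫ ω, Y n ω ^ 2 ∂P = ∫ x, f x ^ 2 ∂κ := by
    intro n
    rw [← (hmp (n + 1)).map_eq, integral_map (hmp (n + 1)).measurable.aemeasurable
      (hfm.pow_const 2).aestronglyMeasurable]
  have hbY2 : ∀ n, MemLp (fun ω => b n ω * Y n ω) 2 P := by
    intro n
    refine (hY2 n).mono (((measurable_of_piLE (hb n)).mul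
      (measurable_of_piLE (hYm n))).aestronglyMeasurable) (ae_of_all _ fun ω => ?_)
    rw [norm_mul]
    exact mul_le_of_le_one_left (norm_nonneg _) (hb1 n ω)
  have hMm : ∀ n, Measurable[𝓕 n] (M n) := by
    intro n
    refine Finset.measurable_fun_sum _ fun l hl => ?_
    have hl' : l + 1 ≤ n := Finset.mem_range.1 hl
    exact (((hb l).mono (𝓕.mono (by omega)) le_rfl).mul
      ((hYm l).mono (𝓕.mono hl') le_rfl)).div_const _
  have hM2 : ∀ n, MemLp (M n) 2 P := by
    intro n
    refine memLp_finsetSum _ fun l _ => ?_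
    simpa only [div_eq_mul_inv] using (hbY2 l).mul_const _
  have hind : ∀ n (g : (ℕ → E) → ℝ), Measurable[𝓕 n] g → ∫ ω, g ω * Y n ω ∂P = 0 := by
    intro n g hg
    have := (indepFun_of_piLE κ hg hfm).integral_fun_mul_eq_mul_integral
      (measurable_of_piLE hg).aestronglyMeasurable
      (hfm.comp (measurable_pi_apply (n + 1))).aestronglyMeasurable
    exact this.trans (by rw [hY0 n, mul_zero])
  have hmart : Martingale M 𝓕 P := by
    refine martingale_of_condExp_sub_eq_zero_nat (fun n => (hMm n).stronglyMeasurable)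
      (fun n => (hM2 n).integrable one_le_two) fun n => ?_
    have hdiff : M (n + 1) - M n = (fun ω => b n ω / (n + 1)) * Y n := by
      funext ω
      simp only [hM, Pi.sub_apply, Pi.mul_apply, Finset.sum_range_succ]
      ring
    rw [hdiff]
    refine (condExp_mul_of_stronglyMeasurable_left ((hb n).div_const _).stronglyMeasurable ?_
      ((hY2 n).integrable one_le_two)).trans ?_
    · refine (((hbY2 n).integrable one_le_two).mul_const ((n : ℝ) + 1)⁻¹).congr
        (ae_of_all _ fun ω => ?_)
      simp only [Pi.mul_apply]
      ring
    · have := condExp_indep_eq (μ := P) (m₂ := 𝓕 n) (f := Y n)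
        (measurable_pi_apply (n + 1)).comap_le (𝓕.le n)
        (hfm.comp (comap_measurable _)).stronglyMeasurable (indep_piLE_eval_succ κ n).symm
      filter_upwards [this] with ω hω
      simp [hω, hY0 n]
  set σ := ∫ x, f x ^ 2 ∂κ with hσ
  have hσ0 : 0 ≤ σ := integral_nonneg fun x => sq_nonneg _
  -- Increments are orthogonal, the `n`-th with variance at most `σ/(n+1)²`. The bound telescopes
  -- because `1/(n+1)² ≤ 2 (1/(n+1) - 1/(n+2))`.
  have hbound : ∀ n : ℕ, ∫ ω, M n ω ^ 2 ∂P ≤ 2 * σ * (1 - 1 / ((n : ℝ) + 1)) := by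
    intro n
    induction n with
    | zero => simp [hM]
    | succ n ih =>
      have hexp : ∀ ω, M (n + 1) ω ^ 2 = M n ω ^ 2 + (2 * M n ω * b n ω / (n + 1)) * Y n ω
          + (b n ω * Y n ω) ^ 2 / (n + 1) ^ 2 := by
        intro ω
        simp only [hM, Finset.sum_range_succ]
        field_simp
        ring
      have hi1 : Integrable (fun ω => M n ω ^ 2) P := (hM2 n).integrable_sq
      have hi3 : Integrable (fun ω => (b n ω * Y n ω) ^ 2 / ((n : ℝ) + 1) ^ 2) P :=
        (hbY2 n).integrable_sq.div_const _
      have hi2 : Integrable (fun ω => (2 * M n ω * b n ω / (n + 1)) * Y n ω) P := by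
        refine (((hM2 n).integrable_mul (hbY2 n)).const_mul (2 / ((n : ℝ) + 1))).congr
          (ae_of_all _ fun ω => ?_)
        simp only [Pi.mul_apply]
        ring
      have h3 : ∫ ω, (b n ω * Y n ω) ^ 2 / ((n : ℝ) + 1) ^ 2 ∂P ≤ σ / ((n : ℝ) + 1) ^ 2 := by
        rw [integral_div]
        gcongr
        rw [← hYsq n]
        refine integral_mono (hbY2 n).integrable_sq (hY2 n).integrable_sq fun ω => ?_
        simp only [mul_pow]
        exact mul_le_of_le_one_left (sq_nonneg _) ((sq_le_one_iff_abs_le_one _).2 (hb1 n ω))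
      have h2 : ∫ ω, (2 * M n ω * b n ω / (n + 1)) * Y n ω ∂P = 0 :=
        hind n _ ((((hMm n).const_mul 2).mul (hb n)).div_const _)
      have hi12 : Integrable
          (fun ω => M n ω ^ 2 + (2 * M n ω * b n ω / (n + 1)) * Y n ω) P := hi1.add hi2
      simp_rw [hexp]
      rw [integral_add hi12 hi3, integral_add hi1 hi2, h2]
      have h4 : σ / ((n : ℝ) + 1) ^ 2 ≤ 2 * σ * (1 / ((n : ℝ) + 1) - 1 / ((n : ℝ) + 1 + 1)) := by
        have hn : (0 : ℝ) < (n : ℝ) + 1 := by positivity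
        have hn2 : (0 : ℝ) < (n : ℝ) + 1 + 1 := by positivity
        have : 2 * σ * (1 / ((n : ℝ) + 1) - 1 / ((n : ℝ) + 1 + 1)) - σ / ((n : ℝ) + 1) ^ 2
            = σ * n / (((n : ℝ) + 1) ^ 2 * ((n : ℝ) + 1 + 1)) := by
          field_simp
          ring
        have h5 : 0 ≤ σ * n / (((n : ℝ) + 1) ^ 2 * ((n : ℝ) + 1 + 1)) := by positivity
        linarith
      push_cast
      linarith
  have hL1 : ∀ n, eLpNorm (M n) 1 P ≤ ((1 + 2 * σ).toNNReal : ℝ≥0∞) := by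
    intro n
    have hint := (hM2 n).integrable one_le_two
    rw [eLpNorm_one_eq_lintegral_enorm, ← ofReal_integral_norm_eq_lintegral_enorm hint]
    refine ENNReal.ofReal_le_ofReal ?_
    have : ∫ ω, ‖M n ω‖ ∂P ≤ ∫ ω, (1 + M n ω ^ 2) ∂P := by
      refine integral_mono hint.norm ((integrable_const _).add (hM2 n).integrable_sq) fun ω => ?_
      simp only [Real.norm_eq_abs]
      rw [← sq_abs (M n ω)]
      nlinarith [sq_nonneg (|M n ω| - 1), abs_nonneg (M n ω)]
    rw [integral_add (integrable_const _) (hM2 n).integrable_sq] at this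
    simp only [integral_const, probReal_univ, smul_eq_mul, mul_one] at this
    have h6 : 0 ≤ 2 * σ * (1 / ((n : ℝ) + 1)) := by positivity
    linarith [hbound n]
  filter_upwards [hmart.submartingale.exists_ae_tendsto_of_bdd hL1] with ω ⟨c, hc⟩
  exact tendsto_average_of_tendsto_sum_div hc

end PredictableTransform

end ASHT

namespace ASHT
namespace Model

/-! ### One observation: relative entropy and Hellinger affinity -/

section Observation

variable {M : ℕ} {𝒜 𝒳 : Type*} [MeasurableSpace 𝒳] {m : Model M 𝒜 𝒳}

/-- The log-likelihood ratio of hypothesis `i` against `j` for one observation under action `a`. -/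
noncomputable def logRatio (m : Model M 𝒜 𝒳) (i j : Fin M) (a : 𝒜) (x : 𝒳) : ℝ :=
  Real.log (m.q i a x) - Real.log (m.q j a x)

/-- The mean of `logRatio i j a` under hypothesis `i`. -/
noncomputable def drift (m : Model M 𝒜 𝒳) (i j : Fin M) (a : 𝒜) : ℝ :=
  ∫ x, m.logRatio i j a x ∂(m.obs i a)

theorem measurable_logRatio (i j : Fin M) (a : 𝒜) : Measurable (m.logRatio i j a) :=
  (Real.measurable_log.comp (m.measurable_q i a)).sub (Real.measurable_log.comp (m.measurable_q j a))

theorem AssumptionI.ae_pos (hI : m.AssumptionI) (i : Fin M) (a : 𝒜) :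
    ∀ᵐ x ∂(m.obs i a), ∀ k, 0 < m.q k a x :=
  ae_all_iff.2 fun k => (hI i k a).1

theorem AssumptionI.log_div_ae_eq (hI : m.AssumptionI) (i j : Fin M) (a : 𝒜) :
    (fun x => Real.log (m.q i a x / m.q j a x)) =ᵐ[m.obs i a] m.logRatio i j a := by
  filter_upwards [hI.ae_pos i a] with x hx
  exact Real.log_div (hx i).ne' (hx j).ne'

theorem AssumptionI.memLp_logRatio (hI : m.AssumptionI) (i j : Fin M) (a : 𝒜) :
    MemLp (m.logRatio i j a) 2 (m.obs i a) := by
  rw [memLp_two_iff_integrable_sq (measurable_logRatio i j a).aestronglyMeasurable]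
  refine (hI i j a).2.congr ?_
  filter_upwards [hI.log_div_ae_eq i j a] with x hx
  rw [hx]

/-- By (I), `q_j` vanishes only where `q_i` does, up to `μ`-null sets. Working relative to the
probability measure `obs j a` identifies the Radon–Nikodym derivative without σ-finiteness of `μ`.
-/
theorem AssumptionI.obs_eq_withDensity (hI : m.AssumptionI) (i j : Fin M) (a : 𝒜) :
    m.obs i a = (m.obs j a).withDensity fun x => ENNReal.ofReal (m.q i a x / m.q j a x) := by
  have hm : Measurable fun x => ENNReal.ofReal (m.q i a x / m.q j a x) :=
    ((m.measurable_q i a).div (m.measurable_q j a)).ennreal_ofReal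
  rw [obs, obs, ← withDensity_mul _ (m.measurable_q j a).ennreal_ofReal hm]
  refine withDensity_congr_ae ?_
  have h := (ae_withDensity_iff (m.measurable_q i a).ennreal_ofReal).1 (hI i j a).1
  filter_upwards [h] with x hx
  rw [Pi.mul_apply, ← ENNReal.ofReal_mul (m.q_nonneg j a x)]
  by_cases hi : m.q i a x = 0
  · simp [hi]
  · have hpos : 0 < m.q i a x := lt_of_le_of_ne (m.q_nonneg i a x) (Ne.symm hi)
    rw [mul_div_cancel₀ _ (hx (by simpa using hpos)).ne']

theorem AssumptionI.llr_ae_eq (hI : m.AssumptionI) (i j : Fin M) (a : 𝒜) :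
    llr (m.obs i a) (m.obs j a) =ᵐ[m.obs i a] m.logRatio i j a := by
  have hm : Measurable fun x => ENNReal.ofReal (m.q i a x / m.q j a x) :=
    ((m.measurable_q i a).div (m.measurable_q j a)).ennreal_ofReal
  have hac : m.obs i a ≪ m.obs j a := by
    rw [hI.obs_eq_withDensity i j a]
    exact withDensity_absolutelyContinuous _ _
  have h := Measure.rnDeriv_withDensity (m.obs j a) hm
  rw [← hI.obs_eq_withDensity i j a] at h
  filter_upwards [hac.ae_le h, hI.log_div_ae_eq i j a] with x hx hx2
  rw [llr, hx, ENNReal.toReal_ofReal (div_nonneg (m.q_nonneg i a x) (m.q_nonneg j a x)), hx2]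

theorem AssumptionI.relEnt_eq (hI : m.AssumptionI) (i j : Fin M) (a : 𝒜) :
    m.relEnt i j a = ENNReal.ofReal (m.drift i j a) := by
  have hac : m.obs i a ≪ m.obs j a := by
    rw [hI.obs_eq_withDensity i j a]
    exact withDensity_absolutelyContinuous _ _
  have hint : Integrable (llr (m.obs i a) (m.obs j a)) (m.obs i a) :=
    ((hI.memLp_logRatio i j a).integrable one_le_two).congr (hI.llr_ae_eq i j a).symm
  rw [relEnt, InformationTheory.klDiv_of_ac_of_integrable hac hint,
    integral_congr_ae (hI.llr_ae_eq i j a)]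
  simp [drift]

/-- Gibbs' inequality. It ensures that the `ENNReal.ofReal` in `relEnt_eq` truncates nothing. -/
theorem AssumptionI.drift_nonneg (hI : m.AssumptionI) (i j : Fin M) (a : 𝒜) :
    0 ≤ m.drift i j a := by
  have hac : m.obs i a ≪ m.obs j a := by
    rw [hI.obs_eq_withDensity i j a]
    exact withDensity_absolutelyContinuous _ _
  have h := InformationTheory.toReal_klDiv_of_measure_eq hac (by simp)
  rw [integral_congr_ae (hI.llr_ae_eq i j a)] at h
  rw [drift, ← h]
  exact ENNReal.toReal_nonneg

/-- The Hellinger affinity `E_i[(q_j / q_i)^{1/2}]`. -/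
noncomputable def affinity (m : Model M 𝒜 𝒳) (i j : Fin M) (a : 𝒜) : ℝ≥0∞ :=
  ∫⁻ x, ENNReal.ofReal (Real.exp (-(m.logRatio i j a x) / 2)) ∂(m.obs i a)

theorem measurable_exp_logRatio (i j : Fin M) (a : 𝒜) :
    Measurable fun x => Real.exp (-(m.logRatio i j a x) / 2) :=
  Real.measurable_exp.comp ((measurable_logRatio i j a).neg.div_const 2)

/-- The square is `q_j / q_i`, and integrating it against `q_i` counts only the mass of `q_j` on
`{q_i > 0}`. -/
theorem AssumptionI.lintegral_exp_sq_le (hI : m.AssumptionI) (i j : Fin M) (a : 𝒜) :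
    ∫⁻ x, ENNReal.ofReal (Real.exp (-(m.logRatio i j a x) / 2) ^ 2) ∂(m.obs i a) ≤ 1 := by
  have hm : Measurable fun x => ENNReal.ofReal (m.q j a x / m.q i a x) :=
    ((m.measurable_q j a).div (m.measurable_q i a)).ennreal_ofReal
  have h1 : ∫⁻ x, ENNReal.ofReal (Real.exp (-(m.logRatio i j a x) / 2) ^ 2) ∂(m.obs i a)
      = ∫⁻ x, ENNReal.ofReal (m.q j a x / m.q i a x) ∂(m.obs i a) := by
    refine lintegral_congr_ae ?_
    filter_upwards [hI.ae_pos i a] with x hx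
    rw [← Real.exp_nat_mul, logRatio, ← Real.exp_log (div_pos (hx j) (hx i)),
      Real.log_div (hx j).ne' (hx i).ne']
    congr 2
    push_cast
    ring
  rw [h1, obs, lintegral_withDensity_eq_lintegral_mul _ (m.measurable_q i a).ennreal_ofReal hm,
    ← m.lintegral_q j a]
  refine lintegral_mono fun x => ?_
  rw [Pi.mul_apply, ← ENNReal.ofReal_mul (m.q_nonneg i a x)]
  refine ENNReal.ofReal_le_ofReal ?_
  by_cases hi : m.q i a x = 0
  · simp [hi, m.q_nonneg j a x]
  · rw [mul_div_cancel₀ _ hi]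

theorem AssumptionI.memLp_exp (hI : m.AssumptionI) (i j : Fin M) (a : 𝒜) :
    MemLp (fun x => Real.exp (-(m.logRatio i j a x) / 2)) 2 (m.obs i a) := by
  rw [memLp_two_iff_integrable_sq (measurable_exp_logRatio i j a).aestronglyMeasurable]
  rw [← lintegral_ofReal_ne_top_iff_integrable
    ((measurable_exp_logRatio i j a).pow_const 2).aestronglyMeasurable
    (ae_of_all _ fun x => sq_nonneg _)]
  exact ((hI.lintegral_exp_sq_le i j a).trans_lt ENNReal.one_lt_top).ne

/-- Expand the square and bound the second moment by 1. Nonnegativity of the left side gives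
affinity at most 1; its vanishing describes the case of equality. -/
theorem AssumptionI.integral_exp_sub_one_sq_le (hI : m.AssumptionI) (i j : Fin M) (a : 𝒜) :
    ∫ x, (Real.exp (-(m.logRatio i j a x) / 2) - 1) ^ 2 ∂(m.obs i a) ≤
      2 - 2 * ∫ x, Real.exp (-(m.logRatio i j a x) / 2) ∂(m.obs i a) := by
  have hE := hI.memLp_exp i j a
  have hE1 := (hE.integrable one_le_two).const_mul 2
  have hsq : ∫ x, Real.exp (-(m.logRatio i j a x) / 2) ^ 2 ∂(m.obs i a) ≤ 1 := by
    rw [integral_eq_lintegral_of_nonneg_ae (ae_of_all _ fun x => sq_nonneg _)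
      hE.integrable_sq.aestronglyMeasurable]
    exact ENNReal.toReal_le_of_le_ofReal zero_le_one
      (by simpa using hI.lintegral_exp_sq_le i j a)
  have hexp : ∀ x, (Real.exp (-(m.logRatio i j a x) / 2) - 1) ^ 2 =
      Real.exp (-(m.logRatio i j a x) / 2) ^ 2 - 2 * Real.exp (-(m.logRatio i j a x) / 2) + 1 :=
    fun x => by ring
  have h12 : Integrable (fun x => Real.exp (-(m.logRatio i j a x) / 2) ^ 2
      - 2 * Real.exp (-(m.logRatio i j a x) / 2)) (m.obs i a) := hE.integrable_sq.sub hE1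
  simp_rw [hexp]
  rw [integral_add h12 (integrable_const _), integral_sub hE.integrable_sq hE1,
    integral_const_mul]
  simp only [integral_const, probReal_univ, smul_eq_mul, mul_one]
  linarith

theorem AssumptionI.affinity_eq (hI : m.AssumptionI) (i j : Fin M) (a : 𝒜) :
    m.affinity i j a =
      ENNReal.ofReal (∫ x, Real.exp (-(m.logRatio i j a x) / 2) ∂(m.obs i a)) :=
  (ofReal_integral_eq_lintegral_ofReal ((hI.memLp_exp i j a).integrable one_le_two)
    (ae_of_all _ fun _ => (Real.exp_pos _).le)).symm

theorem AssumptionI.affinity_le_one (hI : m.AssumptionI) (i j : Fin M) (a : 𝒜) :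
    m.affinity i j a ≤ 1 := by
  rw [hI.affinity_eq, ENNReal.ofReal_le_one]
  have h := hI.integral_exp_sub_one_sq_le i j a
  have h0 : 0 ≤ ∫ x, (Real.exp (-(m.logRatio i j a x) / 2) - 1) ^ 2 ∂(m.obs i a) :=
    integral_nonneg fun x => sq_nonneg _
  linarith

/-- Affinity 1 would force the likelihood ratio to equal 1 almost surely, and then the relative
entropy would be zero. -/
theorem AssumptionI.affinity_lt_one (hI : m.AssumptionI) {i j : Fin M} {a : 𝒜}
    (ha : 0 < m.relEnt i j a) : m.affinity i j a < 1 := by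
  refine lt_of_le_of_ne (hI.affinity_le_one i j a) fun h1 => ?_
  have hval : ∫ x, Real.exp (-(m.logRatio i j a x) / 2) ∂(m.obs i a) = 1 := by
    rwa [hI.affinity_eq, ENNReal.ofReal_eq_one] at h1
  have h := hI.integral_exp_sub_one_sq_le i j a
  rw [hval] at h
  have h0 : ∫ x, (Real.exp (-(m.logRatio i j a x) / 2) - 1) ^ 2 ∂(m.obs i a) = 0 :=
    le_antisymm (by linarith) (integral_nonneg fun x => sq_nonneg _)
  have hint : Integrable (fun x => (Real.exp (-(m.logRatio i j a x) / 2) - 1) ^ 2) (m.obs i a) :=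
    ((hI.memLp_exp i j a).sub (memLp_const 1)).integrable_sq
  rw [integral_eq_zero_iff_of_nonneg (fun x => sq_nonneg _) hint] at h0
  have hz : m.logRatio i j a =ᵐ[m.obs i a] 0 := by
    filter_upwards [h0] with x hx
    have h2 : Real.exp (-(m.logRatio i j a x) / 2) = 1 := by
      simpa [sub_eq_zero] using hx
    have h3 := Real.exp_eq_one_iff _ |>.1 h2
    simp only [Pi.zero_apply]
    linarith
  rw [hI.relEnt_eq, drift, integral_congr_ae hz] at ha
  simp at ha

end Observation

end Model
end ASHT

namespace ASHT

theorem mem_argmax {M : ℕ} {z : Fin M → ℝ} {k : Fin M} : k ∈ argmax z ↔ ∀ j, z j ≤ z k := by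
  simp [argmax]

namespace Model

variable {M : ℕ} {𝒜 𝒳 : Type*} [MeasurableSpace 𝒳] {m : Model M 𝒜 𝒳}

/-! ### Law of the fresh randomness -/

section NoiseLaw

variable [Fintype 𝒜] [MeasurableSpace 𝒜] {lam : Fin M → PMF 𝒜} {η : unitInterval} {i : Fin M}

/-- When `k` leads, only these three components matter for an observation under `a`; the tie-break
and the unused proposals and observations integrate out. -/
theorem measurePreserving_noise (k : Fin M) (a : 𝒜) :
    MeasurePreserving (fun w : Noise M 𝒜 𝒳 => (w.1, w.2.1 k, w.2.2.1 a)) (m.noiseLaw lam η i)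
      ((ProbabilityTheory.bernoulliMeasure true false η).prod
        ((lam k).toMeasure.prod (m.obs i a))) :=
  (MeasurePreserving.id _).prod ((measurePreserving_eval _ k).prod
    ((measurePreserving_eval _ a).comp measurePreserving_fst))

theorem lintegral_noise (k : Fin M) (a : 𝒜) {α : Bool → ℝ≥0∞} {β : 𝒜 → ℝ≥0∞} {g : 𝒳 → ℝ≥0∞}
    (hα : Measurable α) (hβ : Measurable β) (hg : Measurable g) :
    ∫⁻ w, α w.1 * (β (w.2.1 k) * g (w.2.2.1 a)) ∂(m.noiseLaw lam η i) =
      (∫⁻ u, α u ∂(ProbabilityTheory.bernoulliMeasure true false η)) *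
        ((∫⁻ b, β b ∂(lam k).toMeasure) * ∫⁻ x, g x ∂(m.obs i a)) := by
  have hm : Measurable fun p : 𝒜 × 𝒳 => β p.1 * g p.2 := by fun_prop
  have h := (measurePreserving_noise (m := m) (lam := lam) (η := η) (i := i) k a).lintegral_comp
    (f := fun p => α p.1 * (β p.2.1 * g p.2.2)) (by fun_prop)
  rw [h, lintegral_prod_mul hα.aemeasurable hm.aemeasurable,
    lintegral_prod_mul hβ.aemeasurable hg.aemeasurable]

theorem integral_noise (k : Fin M) (a : 𝒜) {α : Bool → ℝ} {β : 𝒜 → ℝ} {g : 𝒳 → ℝ}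
    (hα : Measurable α) (hβ : Measurable β) (hg : Measurable g) :
    ∫ w, α w.1 * (β (w.2.1 k) * g (w.2.2.1 a)) ∂(m.noiseLaw lam η i) =
      (∫ u, α u ∂(ProbabilityTheory.bernoulliMeasure true false η)) *
        ((∫ b, β b ∂(lam k).toMeasure) * ∫ x, g x ∂(m.obs i a)) := by
  have hmp := measurePreserving_noise (m := m) (lam := lam) (η := η) (i := i) k a
  have hm : Measurable fun p : Bool × 𝒜 × 𝒳 => α p.1 * (β p.2.1 * g p.2.2) := by fun_prop
  have h := integral_map hmp.measurable.aemeasurable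
    (hm.aestronglyMeasurable (μ := Measure.map _ (m.noiseLaw lam η i)))
  rw [hmp.map_eq] at h
  rw [← h, integral_prod_mul α (fun p : 𝒜 × 𝒳 => β p.1 * g p.2), integral_prod_mul β g]

theorem memLp_noise (k : Fin M) (a : 𝒜) {α : Bool → ℝ} {β : 𝒜 → ℝ} {g : 𝒳 → ℝ}
    (hα : Measurable α) (hβ : Measurable β) (hg : MemLp g 2 (m.obs i a)) (hgm : Measurable g)
    (hα1 : ∀ u, |α u| ≤ 1) (hβ1 : ∀ b, |β b| ≤ 1) :
    MemLp (fun w : Noise M 𝒜 𝒳 => α w.1 * (β (w.2.1 k) * g (w.2.2.1 a))) 2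
      (m.noiseLaw lam η i) := by
  have hx : MeasurePreserving (fun w : Noise M 𝒜 𝒳 => w.2.2.1 a) (m.noiseLaw lam η i)
      (m.obs i a) :=
    (measurePreserving_snd.comp measurePreserving_snd).comp (measurePreserving_noise k a)
  refine (hg.comp_measurePreserving hx).mono (Measurable.aestronglyMeasurable (by fun_prop))
    (ae_of_all _ fun w => ?_)
  rw [norm_mul, norm_mul]
  refine (mul_le_of_le_one_left (by positivity) (hα1 _)).trans
    (mul_le_of_le_one_left (by positivity) (hβ1 _))

theorem lintegral_bernoulli (η : unitInterval) (α : Bool → ℝ≥0∞) :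
    ∫⁻ u, α u ∂(ProbabilityTheory.bernoulliMeasure true false η) =
      ENNReal.ofReal η * α true + ENNReal.ofReal (1 - η) * α false := by
  have h1 : ((unitInterval.toNNReal η : NNReal) : ℝ≥0∞) = ENNReal.ofReal η := by
    rw [ENNReal.ofReal, Real.toNNReal_of_nonneg η.2.1]; rfl
  have h2 : ((unitInterval.toNNReal (unitInterval.symm η) : NNReal) : ℝ≥0∞) =
      ENNReal.ofReal (1 - η) := by
    rw [ENNReal.ofReal, Real.toNNReal_of_nonneg (sub_nonneg.2 η.2.2)]; rfl
  rw [ProbabilityTheory.bernoulliMeasure_def, lintegral_add_measure, ← h1, ← h2]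
  simp only [lintegral_smul_measure, lintegral_dirac, ENNReal.smul_def, smul_eq_mul]

theorem integral_bernoulli (η : unitInterval) (α : Bool → ℝ) :
    ∫ u, α u ∂(ProbabilityTheory.bernoulliMeasure true false η) =
      η * α true + (1 - η) * α false := by
  rw [ProbabilityTheory.integral_bernoulliMeasure]
  simp

theorem integral_indicator_pmf [MeasurableSingletonClass 𝒜] (p : PMF 𝒜) (a : 𝒜) [DecidableEq 𝒜] :
    ∫ b, (if b = a then (1 : ℝ) else 0) ∂p.toMeasure = (p a).toReal := by
  rw [PMF.integral_eq_sum]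
  simp

theorem lintegral_indicator_pmf [MeasurableSingletonClass 𝒜] (p : PMF 𝒜) (a : 𝒜) [DecidableEq 𝒜] :
    ∫⁻ b, (if b = a then (1 : ℝ≥0∞) else 0) ∂p.toMeasure = p a := by
  rw [lintegral_fintype]
  simp

theorem ae_tieBreak_mem : ∀ᵐ w ∂(m.noiseLaw lam η i), ∀ S : {S : Finset (Fin M) // S.Nonempty},
    w.2.2.2 S ∈ S.1 := by
  refine ae_all_iff.2 fun S => ?_
  have hmp : MeasurePreserving (fun w : Noise M 𝒜 𝒳 => w.2.2.2 S) (m.noiseLaw lam η i)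
      (PMF.uniformOfFinset S.1 S.2).toMeasure :=
    (measurePreserving_eval _ S).comp
      (measurePreserving_snd.comp (measurePreserving_snd.comp measurePreserving_snd))
  refine hmp.quasiMeasurePreserving.ae (p := fun k => k ∈ S.1) ?_
  rw [ae_iff, PMF.toMeasure_apply_eq_zero_iff _ (MeasurableSet.of_discrete)]
  simp [Set.disjoint_left]

end NoiseLaw

/-! ### The run is adapted -/

section Measurability

variable [Finite 𝒜] [MeasurableSpace 𝒜] [MeasurableSingletonClass 𝒜] [NeZero M]

/-- The leader is an evaluation of the tie-break at the set of maximizers. That set takes finitely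
many values, each on an event given by comparisons of the log-likelihoods. -/
theorem measurable_observe {Ω : Type*} [MeasurableSpace Ω] {z : Ω → Fin M → ℝ} {a : Ω → 𝒜}
    {w : Ω → Noise M 𝒜 𝒳} (hz : Measurable z) (ha : Measurable a) (hw : Measurable w) :
    (Measurable fun ω => (m.observe (z ω) (a ω) (w ω)).action) ∧
    (Measurable fun ω => (m.observe (z ω) (a ω) (w ω)).Z) ∧
    (Measurable fun ω => (m.observe (z ω) (a ω) (w ω)).leader) := by
  have hZ : Measurable fun ω => (m.observe (z ω) (a ω) (w ω)).Z := by
    refine measurable_pi_lambda _ fun k => ?_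
    have h1 : Measurable fun p : 𝒜 × (𝒜 → 𝒳) => Real.log (m.q k p.1 (p.2 p.1)) :=
      measurable_from_prod_countable_right fun b =>
        Real.measurable_log.comp ((m.measurable_q k b).comp (measurable_pi_apply b))
    exact ((measurable_pi_apply k).comp hz).add (h1.comp (ha.prodMk (by fun_prop)))
  refine ⟨ha, hZ, ?_⟩
  let _ : MeasurableSpace {S : Finset (Fin M) // S.Nonempty} := ⊤
  have h2 : Measurable fun p : {S : Finset (Fin M) // S.Nonempty} ×
      ({S : Finset (Fin M) // S.Nonempty} → Fin M) => p.2 p.1 :=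
    measurable_from_prod_countable_right fun S => measurable_pi_apply S
  have h3 : Measurable fun ω => (⟨argmax (m.observe (z ω) (a ω) (w ω)).Z,
      argmax_nonempty _⟩ : {S : Finset (Fin M) // S.Nonempty}) := by
    refine measurable_to_countable' fun S => ?_
    have : (fun ω => (⟨argmax (m.observe (z ω) (a ω) (w ω)).Z,
        argmax_nonempty _⟩ : {S : Finset (Fin M) // S.Nonempty})) ⁻¹' {S} =
        ⋂ k, {ω | (∀ j, (m.observe (z ω) (a ω) (w ω)).Z j ≤ (m.observe (z ω) (a ω) (w ω)).Z k) ↔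
          k ∈ S.1} := by
      ext ω
      simp [Subtype.ext_iff, Finset.ext_iff, mem_argmax]
    rw [this]
    refine MeasurableSet.iInter fun k => ?_
    refine MeasurableSet.iff ?_ (MeasurableSet.const _)
    rw [Set.ofPred_forall]
    refine MeasurableSet.iInter fun j => ?_
    exact measurableSet_le ((measurable_pi_apply j).comp hZ) ((measurable_pi_apply k).comp hZ)
  exact h2.comp (h3.prodMk (by fun_prop))

theorem measurable_run (a₁ : 𝒜) (n : ℕ) :
    (Measurable[Filtration.piLE (X := fun _ : ℕ => Noise M 𝒜 𝒳) n]
      fun ω => (m.run (a₁, ω) n).action) ∧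
    (Measurable[Filtration.piLE (X := fun _ : ℕ => Noise M 𝒜 𝒳) n]
      fun ω => (m.run (a₁, ω) n).Z) ∧
    (Measurable[Filtration.piLE (X := fun _ : ℕ => Noise M 𝒜 𝒳) n]
      fun ω => (m.run (a₁, ω) n).leader) := by
  induction n with
  | zero =>
    exact @measurable_observe _ _ _ _ m _ _ _ _ _ (Filtration.piLE 0) _ _ _
      measurable_const measurable_const (measurable_piLE_eval le_rfl)
  | succ n ih =>
    obtain ⟨h1, h2, h3⟩ := ih
    have hle : (Filtration.piLE (X := fun _ : ℕ => Noise M 𝒜 𝒳) n) ≤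
        (Filtration.piLE (X := fun _ : ℕ => Noise M 𝒜 𝒳) (n + 1)) :=
      (Filtration.piLE (X := fun _ : ℕ => Noise M 𝒜 𝒳)).mono n.le_succ
    have hw := measurable_piLE_eval (E := Noise M 𝒜 𝒳) (le_refl (n + 1))
    refine @measurable_observe _ _ _ _ m _ _ _ _ _ (Filtration.piLE (n + 1)) _ _ _
      (h2.mono hle le_rfl) ?_ hw
    have h4 : Measurable fun p : Fin M × (Fin M → 𝒜) => p.2 p.1 :=
      measurable_from_prod_countable_right fun k => measurable_pi_apply k
    refine Measurable.ite ?_ ?_ (h1.mono hle le_rfl)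
    · exact (measurable_fst.comp hw) (measurableSet_singleton true)
    · exact h4.comp ((h3.mono hle le_rfl).prodMk (measurable_fst.comp (measurable_snd.comp hw)))

end Measurability

end Model
end ASHT

namespace ASHT
namespace Model

variable {M : ℕ} {𝒜 𝒳 : Type*} [MeasurableSpace 𝒳] {m : Model M 𝒜 𝒳}

/-- The law of the sequence of fresh randomness under hypothesis `i`. -/
noncomputable def noiseSeqLaw [Fintype 𝒜] [MeasurableSpace 𝒜] (m : Model M 𝒜 𝒳)
    (lam : Fin M → PMF 𝒜) (η : unitInterval) (i : Fin M) : Measure (ℕ → Noise M 𝒜 𝒳) :=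
  Measure.infinitePi fun _ : ℕ => m.noiseLaw lam η i

instance [Fintype 𝒜] [MeasurableSpace 𝒜] (lam : Fin M → PMF 𝒜) (η : unitInterval) (i : Fin M) :
    IsProbabilityMeasure (m.noiseSeqLaw lam η i) := by
  unfold noiseSeqLaw; infer_instance

/-- The action taken next, given the leader `k`, the current action `a` and fresh randomness. -/
def nextAction (k : Fin M) (a : 𝒜) (w : Noise M 𝒜 𝒳) : 𝒜 := if w.1 then w.2.1 k else a

/-- The factor by which `(q_j / q_i)^{1/2}` changes when action `a` is taken. -/
noncomputable def rootRatio (m : Model M 𝒜 𝒳) (i j : Fin M) (a : 𝒜) (x : 𝒳) : ℝ≥0∞ :=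
  ENNReal.ofReal (Real.exp (-(m.logRatio i j a x) / 2))

theorem measurable_rootRatio (i j : Fin M) (a : 𝒜) : Measurable (m.rootRatio i j a) :=
  (measurable_exp_logRatio i j a).ennreal_ofReal

theorem lintegral_rootRatio (i j : Fin M) (a : 𝒜) :
    ∫⁻ x, m.rootRatio i j a x ∂(m.obs i a) = m.affinity i j a := rfl

theorem AssumptionIIb.exists_pos [Fintype 𝒜] {lam : Fin M → PMF 𝒜}
    (hIIb : m.AssumptionIIb lam) {i j : Fin M} (hij : i ≠ j) (k : Fin M) : ∃ a, 0 < m.relEnt i j a ∧ 0 < lam k a := by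
  classical
  have h : 0 < ∑ a ∈ Finset.univ.filter (fun a => 0 < m.relEnt i j a), lam k a := by
    refine lt_of_lt_of_le hIIb ?_
    unfold beta
    refine (iInf₂_le_of_le i j ((iInf₂_le_of_le hij k le_rfl).trans (le_of_eq ?_)))
    congr
  obtain ⟨a, ha, h0⟩ := Finset.exists_ne_zero_of_sum_ne_zero h.ne'
  exact ⟨a, (Finset.mem_filter.1 ha).2, pos_iff_ne_zero.2 h0⟩

/-! ### Recursion for the log-likelihood gaps -/

section Run

variable [NeZero M] {i j : Fin M}

theorem run_succ_action (a₁ : 𝒜) (ω : ℕ → Noise M 𝒜 𝒳) (n : ℕ) :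
    (m.run (a₁, ω) (n + 1)).action =
      nextAction (m.run (a₁, ω) n).leader (m.run (a₁, ω) n).action (ω (n + 1)) := rfl

theorem run_succ_Z (a₁ : 𝒜) (ω : ℕ → Noise M 𝒜 𝒳) (n : ℕ) (k : Fin M) :
    (m.run (a₁, ω) (n + 1)).Z k = (m.run (a₁, ω) n).Z k +
      Real.log (m.q k (m.run (a₁, ω) (n + 1)).action
        ((ω (n + 1)).2.2.1 (m.run (a₁, ω) (n + 1)).action)) := rfl

/-- The log-likelihood of hypothesis `i` minus that of `j` at time `n + 1`. -/
noncomputable def gap (m : Model M 𝒜 𝒳) (i j : Fin M) (a₁ : 𝒜) (n : ℕ)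
    (ω : ℕ → Noise M 𝒜 𝒳) : ℝ :=
  (m.run (a₁, ω) n).Z i - (m.run (a₁, ω) n).Z j

theorem gap_zero (a₁ : 𝒜) (ω : ℕ → Noise M 𝒜 𝒳) :
    m.gap i j a₁ 0 ω = m.logRatio i j a₁ ((ω 0).2.2.1 a₁) := by
  simp [gap, run, observe, logRatio]

theorem gap_succ (a₁ : 𝒜) (ω : ℕ → Noise M 𝒜 𝒳) (n : ℕ) :
    m.gap i j a₁ (n + 1) ω = m.gap i j a₁ n ω +
      m.logRatio i j (m.run (a₁, ω) (n + 1)).action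
        ((ω (n + 1)).2.2.1 (m.run (a₁, ω) (n + 1)).action) := by
  rw [gap, gap, run_succ_Z, run_succ_Z, logRatio]
  ring

end Run

/-! ### Contraction over one step -/

section Contraction

variable [Fintype 𝒜] {lam : Fin M → PMF 𝒜} {η : unitInterval} {i j : Fin M}

/-- A bound for the conditional mean of `rootRatio` over one step when `k` leads. -/
noncomputable def contraction (m : Model M 𝒜 𝒳) (lam : Fin M → PMF 𝒜) (η : unitInterval)
    (i j k : Fin M) : ℝ≥0∞ :=
  ENNReal.ofReal η * ∑ a, lam k a * m.affinity i j a + ENNReal.ofReal (1 - η)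

/-- No affinity exceeds 1, and (IIb) supplies an action of positive `λ_k`-mass whose affinity is
strictly smaller. As `η > 0`, the loss survives mixing with the event that the action is kept. -/
theorem contraction_lt_one (hI : m.AssumptionI) (hIIb : m.AssumptionIIb lam) (hη : 0 < η)
    (hij : i ≠ j) (k : Fin M) : m.contraction lam η i j k < 1 := by
  classical
  obtain ⟨a, ha, hla⟩ := hIIb.exists_pos hij k
  have hsum : ∑ a, lam k a = 1 := by
    rw [← tsum_fintype (L := .unconditional _), PMF.tsum_coe]
  have h1 : ∑ a, lam k a * m.affinity i j a < 1 := by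
    rw [← hsum, ← Finset.add_sum_erase _ _ (Finset.mem_univ a),
      ← Finset.add_sum_erase _ (fun a => lam k a) (Finset.mem_univ a)]
    refine ENNReal.add_lt_add_of_lt_of_le ?_ ?_ ?_
    · exact ((Finset.sum_le_sum fun b _ => mul_le_of_le_one_right'
        (hI.affinity_le_one i j b)).trans (Finset.sum_le_univ_sum_of_nonneg fun _ => zero_le)
        |>.trans_lt (hsum ▸ ENNReal.one_lt_top)).ne
    · calc lam k a * m.affinity i j a < lam k a * 1 :=
          (ENNReal.mul_lt_mul_iff_right hla.ne' (PMF.apply_ne_top _ _)).2 (hI.affinity_lt_one ha)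
        _ = lam k a := mul_one _
    · exact Finset.sum_le_sum fun b _ => mul_le_of_le_one_right' (hI.affinity_le_one i j b)
  have hη0 : ENNReal.ofReal η ≠ 0 := (ENNReal.ofReal_pos.2 hη).ne'
  calc m.contraction lam η i j k < ENNReal.ofReal η * 1 + ENNReal.ofReal (1 - η) :=
        ENNReal.add_lt_add_of_lt_of_le ENNReal.ofReal_ne_top
          ((ENNReal.mul_lt_mul_iff_right hη0 ENNReal.ofReal_ne_top).2 h1) le_rfl
    _ = 1 := by
        rw [mul_one, ← ENNReal.ofReal_add η.2.1 (sub_nonneg.2 η.2.2)]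
        simp

theorem exists_contraction_le (hI : m.AssumptionI) (hIIb : m.AssumptionIIb lam) (hη : 0 < η)
    (i : Fin M) : ∃ r : ℝ, 0 < r ∧ r < 1 ∧
      ∀ j, j ≠ i → ∀ k, m.contraction lam η i j k ≤ ENNReal.ofReal r := by
  classical
  set s : ℝ≥0∞ := Finset.univ.sup fun p : Fin M × Fin M =>
    if p.1 ≠ i then m.contraction lam η i p.1 p.2 else 0 with hs
  have hs1 : s < 1 := by
    refine (Finset.sup_lt_iff (by simp)).2 fun p _ => ?_
    split_ifs with h
    · exact contraction_lt_one hI hIIb hη (Ne.symm h) p.2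
    · simp
  have hs2 : s.toReal < 1 := by
    simpa using (ENNReal.toReal_lt_toReal hs1.ne_top ENNReal.one_ne_top).2 hs1
  -- The value `1 / 2` only keeps `r` positive, so that its logarithm can be used later.
  refine ⟨max s.toReal (1 / 2), by positivity, max_lt hs2 (by norm_num), fun j hj k => ?_⟩
  refine le_trans ?_ (ENNReal.ofReal_le_ofReal (le_max_left _ _))
  rw [ENNReal.ofReal_toReal hs1.ne_top]
  refine le_trans ?_ (Finset.le_sup (Finset.mem_univ (j, k)))
  simp [hj]

end Contraction

section OneStep

variable [Fintype 𝒜] [MeasurableSpace 𝒜] [MeasurableSingletonClass 𝒜] {lam : Fin M → PMF 𝒜}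
  {η : unitInterval} {i j : Fin M}

theorem measurable_rootRatio_nextAction (k : Fin M) (a : 𝒜) : Measurable fun w : Noise M 𝒜 𝒳 =>
    m.rootRatio i j (nextAction k a w) (w.2.2.1 (nextAction k a w)) := by
  have h1 : Measurable fun p : 𝒜 × (𝒜 → 𝒳) => m.rootRatio i j p.1 (p.2 p.1) :=
    measurable_from_prod_countable_right fun b =>
      (measurable_rootRatio i j b).comp (measurable_pi_apply b)
  have hs : MeasurableSet {w : Noise M 𝒜 𝒳 | w.1 = true} :=
    measurable_fst (measurableSet_singleton true)
  have h2 : Measurable fun w : Noise M 𝒜 𝒳 => (w.2.1 k, w.2.2.1) := by fun_prop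
  have h3 : Measurable fun w : Noise M 𝒜 𝒳 => m.rootRatio i j a (w.2.2.1 a) :=
    (measurable_rootRatio i j a).comp (by fun_prop)
  have h4 : (fun w : Noise M 𝒜 𝒳 =>
      m.rootRatio i j (nextAction k a w) (w.2.2.1 (nextAction k a w))) =
      fun w => if w.1 = true then m.rootRatio i j (w.2.1 k) (w.2.2.1 (w.2.1 k))
        else m.rootRatio i j a (w.2.2.1 a) := by
    funext w
    cases hw : w.1 <;> simp [nextAction, hw]
  have h5 := h1.comp h2
  rw [Function.comp_def] at h5
  rw [h4]
  exact Measurable.ite hs h5 h3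

/-- Split by the switching bit and, if it is set, by the proposed action; each term is a product of
independent factors. If the action is kept, nothing is known about it, and its affinity is bounded
by 1. -/
theorem AssumptionI.lintegral_rootRatio_nextAction_le (hI : m.AssumptionI) (j k : Fin M) (a : 𝒜) :
    ∫⁻ w, m.rootRatio i j (nextAction k a w) (w.2.2.1 (nextAction k a w)) ∂(m.noiseLaw lam η i) ≤
      m.contraction lam η i j k := by
  classical
  have hdec : ∀ w : Noise M 𝒜 𝒳,
      m.rootRatio i j (nextAction k a w) (w.2.2.1 (nextAction k a w)) =
      (∑ b, (if w.1 then 1 else 0) * ((if w.2.1 k = b then 1 else 0) *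
        m.rootRatio i j b (w.2.2.1 b))) +
      (if w.1 then 0 else 1) * (1 * m.rootRatio i j a (w.2.2.1 a)) := by
    intro w
    cases hw : w.1 <;> simp [nextAction, hw]
  have hα : Measurable fun u : Bool => (if u then 1 else 0 : ℝ≥0∞) := measurable_of_countable _
  have hα' : Measurable fun u : Bool => (if u then 0 else 1 : ℝ≥0∞) := measurable_of_countable _
  have hβ : ∀ b : 𝒜, Measurable fun c : 𝒜 => (if c = b then 1 else 0 : ℝ≥0∞) :=
    fun b => measurable_of_countable _
  have hr := fun b => measurable_rootRatio (m := m) i j b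
  simp_rw [hdec]
  rw [lintegral_add_left, lintegral_finsetSum]
  · rw [lintegral_noise k a hα' measurable_const (hr a), lintegral_bernoulli]
    simp_rw [lintegral_noise k _ hα (hβ _) (hr _), lintegral_bernoulli, lintegral_indicator_pmf,
      lintegral_rootRatio]
    rw [contraction, Finset.mul_sum]
    simp only [if_true, mul_one, Bool.false_eq_true, if_false, mul_zero, add_zero, zero_add,
      lintegral_const, measure_univ, one_mul]
    gcongr
    exact mul_le_of_le_one_right' (hI.affinity_le_one i j a)
  · exact fun b _ => (hα.comp measurable_fst).mul
      (((hβ b).comp (by fun_prop)).mul ((hr b).comp (by fun_prop)))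
  · exact Finset.measurable_fun_sum _ fun b _ => (hα.comp measurable_fst).mul
      (((hβ b).comp (by fun_prop)).mul ((hr b).comp (by fun_prop)))

end OneStep

/-! ### Geometric decay of the probability of a small gap -/

section ExponentialBound

variable [Fintype 𝒜] [MeasurableSpace 𝒜] [MeasurableSingletonClass 𝒜] [NeZero M]
  {lam : Fin M → PMF 𝒜} {η : unitInterval} {i j : Fin M}

theorem measurable_gap (i j : Fin M) (a₁ : 𝒜) (n : ℕ) :
    Measurable[Filtration.piLE (X := fun _ : ℕ => Noise M 𝒜 𝒳) n] (m.gap i j a₁ n) :=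
  ((measurable_pi_apply i).comp (measurable_run a₁ n).2.1).sub
    ((measurable_pi_apply j).comp (measurable_run a₁ n).2.1)

/-- The bound on one step is uniform in leader and current action, so it iterates. The first action
is arbitrary and contributes only a factor at most 1; hence the exponent `n` at time `n + 1`. -/
theorem AssumptionI.lintegral_exp_gap_le (hI : m.AssumptionI) {r : ℝ≥0∞}
    (hr : ∀ k, m.contraction lam η i j k ≤ r) (a₁ : 𝒜) (n : ℕ) :
    ∫⁻ ω, ENNReal.ofReal (Real.exp (-(m.gap i j a₁ n ω) / 2)) ∂(m.noiseSeqLaw lam η i) ≤ r ^ n := by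
  classical
  induction n with
  | zero =>
    simp_rw [gap_zero]
    have hx : MeasurePreserving (fun w : Noise M 𝒜 𝒳 => w.2.2.1 a₁) (m.noiseLaw lam η i)
        (m.obs i a₁) :=
      (measurePreserving_snd.comp measurePreserving_snd).comp (measurePreserving_noise i a₁)
    have h := (hx.comp (measurePreserving_eval_infinitePi
      (fun _ : ℕ => m.noiseLaw lam η i) 0)).lintegral_comp (measurable_rootRatio (m := m) i j a₁)
    rw [lintegral_rootRatio] at h
    exact (le_of_eq h).trans (by simpa using hI.affinity_le_one i j a₁)
  | succ n ih =>
    obtain ⟨hma, -, hml⟩ := measurable_run (m := m) a₁ n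
    have hstep : ∀ ω, ENNReal.ofReal (Real.exp (-(m.gap i j a₁ (n + 1) ω) / 2)) =
        ENNReal.ofReal (Real.exp (-(m.gap i j a₁ n ω) / 2)) *
          m.rootRatio i j (m.run (a₁, ω) (n + 1)).action
            ((ω (n + 1)).2.2.1 (m.run (a₁, ω) (n + 1)).action) := by
      intro ω
      rw [gap_succ, neg_add, add_div, Real.exp_add, ENNReal.ofReal_mul (Real.exp_pos _).le,
        rootRatio]
    simp_rw [hstep, run_succ_action]
    refine (lintegral_mul_eval_succ_le (m.noiseLaw lam η i)
      (s := fun ω => ((m.run (a₁, ω) n).leader, (m.run (a₁, ω) n).action))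
      (X := fun ω => ENNReal.ofReal (Real.exp (-(m.gap i j a₁ n ω) / 2)))
      (G := fun p w => m.rootRatio i j (nextAction p.1 p.2 w) (w.2.2.1 (nextAction p.1 p.2 w)))
      (hml.prodMk hma)
      (Real.measurable_exp.comp ((measurable_gap i j a₁ n).neg.div_const 2)).ennreal_ofReal
      (fun p => measurable_rootRatio_nextAction p.1 p.2)
      (fun p => (hI.lintegral_rootRatio_nextAction_le j p.1 p.2).trans (hr p.1))).trans ?_
    rw [pow_succ]
    exact mul_le_mul_left ih r

/-- Under hypothesis `i`, the probability that the gap to `j` is below a small linear function of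
time decays geometrically. -/
theorem AssumptionI.measure_gap_lt_le (hI : m.AssumptionI) {r κ : ℝ}
    (hr : ∀ k, m.contraction lam η i j k ≤ ENNReal.ofReal r) (a₁ : 𝒜) (n : ℕ) :
    m.noiseSeqLaw lam η i {ω | m.gap i j a₁ n ω < κ * n} ≤
      ENNReal.ofReal (Real.exp (κ / 2) * r) ^ n := by
  -- Chernoff's bound: on the event, `exp ((κ n - gap) / 2)` is at least 1.
  have hle : m.noiseSeqLaw lam η i {ω | m.gap i j a₁ n ω < κ * n} ≤
      ∫⁻ ω, ENNReal.ofReal (Real.exp (κ * n / 2)) *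
        ENNReal.ofReal (Real.exp (-(m.gap i j a₁ n ω) / 2)) ∂(m.noiseSeqLaw lam η i) := by
    rw [← lintegral_indicator_one
      (measurableSet_lt (measurable_of_piLE (measurable_gap i j a₁ n)) measurable_const)]
    refine lintegral_mono fun ω => ?_
    by_cases hω : ω ∈ {ω | m.gap i j a₁ n ω < κ * n}
    swap
    · rw [Set.indicator_of_notMem hω]
      exact zero_le
    rw [Set.indicator_of_mem hω, ← ENNReal.ofReal_mul (Real.exp_pos _).le, ← Real.exp_add, Pi.one_apply,
      ENNReal.one_le_ofReal, Real.one_le_exp_iff]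
    have : m.gap i j a₁ n ω < κ * n := hω
    linarith
  refine hle.trans ?_
  rw [lintegral_const_mul' _ _ ENNReal.ofReal_ne_top]
  calc _ ≤ ENNReal.ofReal (Real.exp (κ * n / 2)) * ENNReal.ofReal r ^ n := by
        gcongr
        exact hI.lintegral_exp_gap_le hr a₁ n
    _ = _ := by
        rw [ENNReal.ofReal_mul (Real.exp_pos _).le, mul_pow,
          ← ENNReal.ofReal_pow (Real.exp_pos _).le, ← Real.exp_nat_mul]
        congr 4
        ring

end ExponentialBound

end Model
end ASHT

namespace ASHT
namespace Model

variable {M : ℕ} {𝒜 𝒳 : Type*} [MeasurableSpace 𝒳] {m : Model M 𝒜 𝒳}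

/-! ### Decomposition of the gaps by action -/

section Pathwise

variable [NeZero M] {i : Fin M}

theorem leader_eq_of_gap_pos {a₁ : 𝒜} {ω : ℕ → Noise M 𝒜 𝒳} {n : ℕ}
    (h : (m.run (a₁, ω) n).leader ∈ argmax (m.run (a₁, ω) n).Z)
    (hpos : ∀ j, j ≠ i → 0 < m.gap i j a₁ n ω) : (m.run (a₁, ω) n).leader = i := by
  by_contra hne
  have h1 := hpos _ hne
  have h2 := mem_argmax.1 h i
  rw [gap] at h1
  linarith

open Classical in
/-- The indicator that the action at time `n + 1` is `a`. -/
noncomputable def actionInd (m : Model M 𝒜 𝒳) (a₁ a : 𝒜) (n : ℕ) (ω : ℕ → Noise M 𝒜 𝒳) : ℝ :=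
  if (m.run (a₁, ω) n).action = a then 1 else 0

open Classical in
-- Each summand is a function of the past times a function of the fresh noise, the form required by
-- the strong law for predictable transforms.
theorem actionInd_succ (a₁ a : 𝒜) (n : ℕ) (ω : ℕ → Noise M 𝒜 𝒳) :
    m.actionInd a₁ a (n + 1) ω =
      (∑ k, (if (m.run (a₁, ω) n).leader = k then 1 else 0) *
        ((if (ω (n + 1)).1 then 1 else 0) * (if (ω (n + 1)).2.1 k = a then 1 else 0))) +
      m.actionInd a₁ a n ω * (if (ω (n + 1)).1 then 0 else 1) := by
  rw [actionInd, actionInd, run_succ_action, nextAction]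
  simp only [ite_mul, one_mul, zero_mul, Finset.sum_ite_eq, Finset.mem_univ, if_true]
  cases hw : (ω (n + 1)).1 <;> simp

theorem abs_actionInd_le_one (a₁ a : 𝒜) (n : ℕ) (ω : ℕ → Noise M 𝒜 𝒳) :
    |m.actionInd a₁ a n ω| ≤ 1 := by
  unfold actionInd
  split_ifs <;> simp

theorem gap_eq_sum [Fintype 𝒜] (i j : Fin M) (a₁ : 𝒜) (n : ℕ) (ω : ℕ → Noise M 𝒜 𝒳) :
    m.gap i j a₁ n ω = m.gap i j a₁ 0 ω + ∑ a, ∑ l ∈ Finset.range n,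
      m.actionInd a₁ a (l + 1) ω * m.logRatio i j a ((ω (l + 1)).2.2.1 a) := by
  classical
  rw [Finset.sum_comm]
  induction n with
  | zero => simp
  | succ n ih =>
    rw [gap_succ, ih, Finset.sum_range_succ]
    simp [actionInd, add_assoc]

end Pathwise

/-! ### The true hypothesis eventually leads -/

section Leader

variable [Fintype 𝒜] [MeasurableSpace 𝒜] [NeZero M]
  {lam : Fin M → PMF 𝒜} {η : unitInterval} {i : Fin M}

theorem ae_leader_mem_argmax (a₁ : 𝒜) : ∀ᵐ ω ∂(m.noiseSeqLaw lam η i), ∀ n,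
    (m.run (a₁, ω) n).leader ∈ argmax (m.run (a₁, ω) n).Z := by
  refine ae_all_iff.2 fun n => ?_
  have h := (measurePreserving_eval_infinitePi
    (fun _ : ℕ => m.noiseLaw lam η i) n).quasiMeasurePreserving.ae
    (ae_tieBreak_mem (m := m) (lam := lam) (η := η) (i := i))
  filter_upwards [h] with ω hω
  cases n with
  | zero => exact hω ⟨_, argmax_nonempty _⟩
  | succ n => exact hω ⟨_, argmax_nonempty _⟩

variable [MeasurableSingletonClass 𝒜]

/-- Under hypothesis `i`, all gaps eventually exceed a linear function; the expected number of
exceptional times is finite. -/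
theorem exists_linear_lower_bound (hI : m.AssumptionI) (hIIb : m.AssumptionIIb lam) (hη : 0 < η)
    (i : Fin M) (a₁ : 𝒜) : ∃ κ : ℝ, 0 < κ ∧
      ∑' n, m.noiseSeqLaw lam η i {ω | ∃ j, j ≠ i ∧ m.gap i j a₁ n ω < κ * n} ≠ ∞ := by
  obtain ⟨r, hr0, hr1, hr⟩ := exists_contraction_le hI hIIb hη i
  -- With this slope the ratio `exp (κ/2) * r` of the geometric bound is `√r < 1`.
  refine ⟨-Real.log r, neg_pos.2 (Real.log_neg hr0 hr1), ?_⟩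
  set κ := -Real.log r with hκ
  set ρ := Real.exp (κ / 2) * r with hρ
  have hρ1 : ρ < 1 := by
    have : ρ = Real.exp (Real.log r / 2) := by
      rw [hρ, ← Real.exp_log hr0, Real.log_exp, ← Real.exp_add, hκ]
      congr 1
      ring
    rw [this, Real.exp_lt_one_iff]
    linarith [Real.log_neg hr0 hr1]
  have hle : ∀ n, m.noiseSeqLaw lam η i {ω | ∃ j, j ≠ i ∧ m.gap i j a₁ n ω < κ * n} ≤
      M * ENNReal.ofReal ρ ^ n := by
    intro n
    have hsub : {ω | ∃ j, j ≠ i ∧ m.gap i j a₁ n ω < κ * n} ⊆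
        ⋃ j ∈ Finset.univ.filter (· ≠ i), {ω | m.gap i j a₁ n ω < κ * n} := by
      rintro ω ⟨j, hj, hlt⟩
      simp only [Set.mem_iUnion]
      exact ⟨j, by simpa using hj, hlt⟩
    refine (measure_mono hsub).trans ((measure_biUnion_finset_le _ _).trans ?_)
    calc _ ≤ ∑ _j ∈ Finset.univ.filter (fun j : Fin M => j ≠ i), ENNReal.ofReal ρ ^ n :=
          Finset.sum_le_sum fun j hj => hI.measure_gap_lt_le
            (hr j (Finset.mem_filter.1 hj).2) a₁ n
      _ ≤ ∑ _j : Fin M, ENNReal.ofReal ρ ^ n := Finset.sum_le_univ_sum_of_nonneg fun _ => zero_le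
      _ = M * ENNReal.ofReal ρ ^ n := by simp
  refine ne_top_of_le_ne_top ?_ (ENNReal.tsum_le_tsum hle)
  rw [ENNReal.tsum_mul_left, ENNReal.tsum_geometric]
  refine ENNReal.mul_ne_top (ENNReal.natCast_ne_top M) (ENNReal.inv_ne_top.2 ?_)
  exact (tsub_pos_of_lt (by simpa using hρ1)).ne'

/-- Borel–Cantelli: almost surely only finitely many times are exceptional, and at any other
positive index all gaps are positive. -/
theorem ae_eventually_leader_eq (hI : m.AssumptionI) (hIIb : m.AssumptionIIb lam) (hη : 0 < η)
    (i : Fin M) (a₁ : 𝒜) : ∀ᵐ ω ∂(m.noiseSeqLaw lam η i),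
      ∀ᶠ n in atTop, (m.run (a₁, ω) n).leader = i := by
  obtain ⟨κ, hκ, hsum⟩ := exists_linear_lower_bound hI hIIb hη i a₁
  filter_upwards [ae_eventually_notMem hsum, ae_leader_mem_argmax (m := m) a₁] with ω h1 h2
  filter_upwards [h1, eventually_gt_atTop 0] with n hn hn0
  refine leader_eq_of_gap_pos (h2 n) fun j hj => ?_
  have h3 : κ * n ≤ m.gap i j a₁ n ω := not_lt.1 fun hlt => hn ⟨j, hj, hlt⟩
  have : 0 < κ * n := by positivity
  linarith

end Leader

/-! ### Action frequencies and growth of the gaps -/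

section Frequencies

variable [Fintype 𝒜] [MeasurableSpace 𝒜] [MeasurableSingletonClass 𝒜] [NeZero M]
  {lam : Fin M → PMF 𝒜} {η : unitInterval} {i : Fin M}

theorem measurable_actionInd (a₁ a : 𝒜) (n : ℕ) :
    Measurable[Filtration.piLE (X := fun _ : ℕ => Noise M 𝒜 𝒳) n] (m.actionInd a₁ a n) :=
  Measurable.ite ((measurable_run a₁ n).1 (measurableSet_singleton a)) measurable_const
    measurable_const

/-- The average of `g` over the observations made under action `a` is asymptotic to its mean times
the average conditional probability of action `a`. -/
theorem ae_tendsto_average_actionInd_mul (a₁ a : 𝒜) {g : 𝒳 → ℝ} (hgm : Measurable g)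
    (hg : MemLp g 2 (m.obs i a)) :
    ∀ᵐ ω ∂(m.noiseSeqLaw lam η i), Tendsto (fun n : ℕ => (n : ℝ)⁻¹ *
      ((∑ l ∈ Finset.range n, m.actionInd a₁ a (l + 1) ω * g ((ω (l + 1)).2.2.1 a)) -
        (∫ x, g x ∂(m.obs i a)) *
          (η * (∑ l ∈ Finset.range n, (lam (m.run (a₁, ω) l).leader a).toReal) +
            (1 - η) * ∑ l ∈ Finset.range n, m.actionInd a₁ a l ω))) atTop (𝓝 0) := by
  classical
  set γ := ∫ x, g x ∂(m.obs i a) with hγ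
  set b : Fin M → ℕ → (ℕ → Noise M 𝒜 𝒳) → ℝ :=
    fun k n ω => if (m.run (a₁, ω) n).leader = k then 1 else 0 with hb
  -- `f k` is the centred contribution of a fresh action drawn when `k` leads, and `f'` that of a
  -- continued action. Their predictable coefficients are the indicators of the leader and of the
  -- current action.
  set f : Fin M → Noise M 𝒜 𝒳 → ℝ := fun k w => (if w.1 then 1 else 0) *
    ((if w.2.1 k = a then 1 else 0) * g (w.2.2.1 a)) - η * ((lam k a).toReal * γ) with hf
  set f' : Noise M 𝒜 𝒳 → ℝ := fun w => (if w.1 then 0 else 1) *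
    (1 * g (w.2.2.1 a)) - (1 - η) * (1 * γ) with hf'
  have hbm : ∀ k n, Measurable[Filtration.piLE (X := fun _ : ℕ => Noise M 𝒜 𝒳) n] (b k n) :=
    fun k n => Measurable.ite ((measurable_run a₁ n).2.2 (measurableSet_singleton k))
      measurable_const measurable_const
  have hb1 : ∀ k n ω, |b k n ω| ≤ 1 := by
    intro k n ω
    simp only [hb]
    split_ifs <;> simp
  have hα : Measurable fun u : Bool => (if u then 1 else 0 : ℝ) := measurable_of_countable _
  have hα' : Measurable fun u : Bool => (if u then 0 else 1 : ℝ) := measurable_of_countable _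
  have hβ : Measurable fun c : 𝒜 => (if c = a then 1 else 0 : ℝ) := measurable_of_countable _
  have hβ' : Measurable fun _ : 𝒜 => (1 : ℝ) := measurable_const
  have hfm : ∀ k, Measurable (f k) := fun k =>
    ((hα.comp measurable_fst).mul ((hβ.comp (by fun_prop)).mul (hgm.comp (by fun_prop)))).sub
      measurable_const
  have hfm' : Measurable f' :=
    ((hα'.comp measurable_fst).mul (measurable_const.mul (hgm.comp (by fun_prop)))).sub
      measurable_const
  have hL : ∀ k, MemLp (fun w : Noise M 𝒜 𝒳 => (if w.1 then 1 else 0 : ℝ) *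
      ((if w.2.1 k = a then 1 else 0) * g (w.2.2.1 a))) 2 (m.noiseLaw lam η i) := fun k =>
    memLp_noise k a hα hβ hg hgm (fun u => by cases u <;> simp) (fun c => by split_ifs <;> simp)
  have hL' : MemLp (fun w : Noise M 𝒜 𝒳 => (if w.1 then 0 else 1 : ℝ) *
      (1 * g (w.2.2.1 a))) 2 (m.noiseLaw lam η i) :=
    memLp_noise i a hα' hβ' hg hgm (fun u => by cases u <;> simp) (fun c => by simp)
  have hf0 : ∀ k, ∫ w, f k w ∂(m.noiseLaw lam η i) = 0 := by
    intro k
    simp only [hf]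
    rw [integral_sub ((hL k).integrable one_le_two) (integrable_const _),
      integral_noise k a hα hβ hgm, integral_bernoulli, integral_indicator_pmf]
    simp [hγ]
  have hf0' : ∫ w, f' w ∂(m.noiseLaw lam η i) = 0 := by
    simp only [hf']
    rw [integral_sub (hL'.integrable one_le_two) (integrable_const _),
      integral_noise i a hα' hβ' hgm, integral_bernoulli]
    simp [hγ]
  have h1 : ∀ᵐ ω ∂(m.noiseSeqLaw lam η i), ∀ k, Tendsto (fun n : ℕ => (n : ℝ)⁻¹ *
      ∑ l ∈ Finset.range n, b k l ω * f k (ω (l + 1))) atTop (𝓝 0) :=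
    ae_all_iff.2 fun k => ae_tendsto_average_predictable_mul _ (hbm k) (hb1 k) (hfm k)
      ((hL k).sub (memLp_const _)) (hf0 k)
  have h2 : ∀ᵐ ω ∂(m.noiseSeqLaw lam η i), Tendsto (fun n : ℕ => (n : ℝ)⁻¹ *
      ∑ l ∈ Finset.range n, m.actionInd a₁ a l ω * f' (ω (l + 1))) atTop (𝓝 0) :=
    ae_tendsto_average_predictable_mul _ (measurable_actionInd a₁ a) (abs_actionInd_le_one a₁ a)
      hfm' (hL'.sub (memLp_const _)) hf0'
  filter_upwards [h1, h2] with ω h1 h2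
  have h3 := (tendsto_finsetSum Finset.univ fun k _ => h1 k).add h2
  rw [Finset.sum_const_zero, add_zero] at h3
  refine h3.congr fun n => ?_
  rw [← Finset.mul_sum, ← mul_add]
  congr 1
  rw [Finset.sum_comm, ← Finset.sum_add_distrib, Finset.mul_sum, Finset.mul_sum,
    ← Finset.sum_add_distrib, Finset.mul_sum, ← Finset.sum_sub_distrib]
  refine Finset.sum_congr rfl fun l _ => ?_
  rw [actionInd_succ]
  simp only [hb, hf, hf', ite_mul, one_mul, zero_mul, Finset.sum_ite_eq, Finset.mem_univ, if_true]
  cases hw : (ω (l + 1)).1 <;> simp <;> ring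

/-- The first average is a Cesàro mean of an eventually constant sequence. For the second, take `g =
1` in the preceding law: shifting the index costs two boundary terms, so `η` times the frequency is
asymptotic to `η` times the first average, and `η` cancels. -/
theorem ae_tendsto_frequency (hI : m.AssumptionI) (hIIb : m.AssumptionIIb lam) (hη : 0 < η)
    (i : Fin M) (a₁ a : 𝒜) : ∀ᵐ ω ∂(m.noiseSeqLaw lam η i),
      Tendsto (fun n : ℕ => (n : ℝ)⁻¹ * ∑ l ∈ Finset.range n,
        (lam (m.run (a₁, ω) l).leader a).toReal) atTop (𝓝 (lam i a).toReal) ∧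
      Tendsto (fun n : ℕ => (n : ℝ)⁻¹ * ∑ l ∈ Finset.range n, m.actionInd a₁ a l ω)
        atTop (𝓝 (lam i a).toReal) := by
  have hη' : (0 : ℝ) < η := hη
  filter_upwards [ae_eventually_leader_eq hI hIIb hη i a₁,
    ae_tendsto_average_actionInd_mul (m := m) (lam := lam) (η := η) (i := i) a₁ a
      (g := fun _ => 1) measurable_const (memLp_const 1)] with ω h1 h2
  have h3 : Tendsto (fun n : ℕ => (n : ℝ)⁻¹ * ∑ l ∈ Finset.range n,
      (lam (m.run (a₁, ω) l).leader a).toReal) atTop (𝓝 (lam i a).toReal) := by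
    refine Tendsto.cesaro (tendsto_const_nhds.congr' ?_)
    filter_upwards [h1] with n hn
    rw [hn]
  refine ⟨h3, ?_⟩
  have h4 : Tendsto (fun n : ℕ => (n : ℝ)⁻¹ * (m.actionInd a₁ a n ω - m.actionInd a₁ a 0 ω))
      atTop (𝓝 0) := by
    refine squeeze_zero_norm (a := fun n : ℕ => (n : ℝ)⁻¹ * 2) (fun n => ?_) ?_
    · rw [norm_mul, norm_inv, Real.norm_natCast]
      gcongr
      refine (norm_sub_le _ _).trans ?_
      have h5 := abs_actionInd_le_one (m := m) a₁ a n ω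
      have h6 := abs_actionInd_le_one (m := m) a₁ a 0 ω
      simp only [Real.norm_eq_abs]
      linarith
    · simpa using (tendsto_inv_atTop_nhds_zero_nat (𝕜 := ℝ)).mul_const 2
  have h5 := ((h2.sub h4).div_const (η : ℝ)).add h3
  rw [sub_zero, zero_div, zero_add] at h5
  refine h5.congr fun n => ?_
  have h6 : ∑ l ∈ Finset.range n, m.actionInd a₁ a (l + 1) ω =
      (∑ l ∈ Finset.range n, m.actionInd a₁ a l ω) +
        (m.actionInd a₁ a n ω - m.actionInd a₁ a 0 ω) := by
    rw [← Finset.sum_range_sub (fun l => m.actionInd a₁ a l ω), ← Finset.sum_add_distrib]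
    exact Finset.sum_congr rfl fun l _ => by ring
  simp only [mul_one, h6, integral_const, probReal_univ, smul_eq_mul]
  field_simp
  ring

/-- Both averages in the conditional probability of `a` tend to `λ_i(a)`, hence so does their
`η`-mixture; each action then contributes its limiting frequency times its drift. -/
theorem ae_tendsto_gap_div (hI : m.AssumptionI) (hIIb : m.AssumptionIIb lam) (hη : 0 < η)
    (i : Fin M) (a₁ : 𝒜) : ∀ᵐ ω ∂(m.noiseSeqLaw lam η i), ∀ j,
      Tendsto (fun n : ℕ => (n : ℝ)⁻¹ * m.gap i j a₁ n ω) atTop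
        (𝓝 (∑ a, (lam i a).toReal * m.drift i j a)) := by
  have h1 : ∀ᵐ ω ∂(m.noiseSeqLaw lam η i), ∀ a, _ :=
    ae_all_iff.2 fun a => ae_tendsto_frequency hI hIIb hη i a₁ a
  have h2 : ∀ᵐ ω ∂(m.noiseSeqLaw lam η i), ∀ j a, _ :=
    ae_all_iff.2 fun j => ae_all_iff.2 fun a => ae_tendsto_average_actionInd_mul
      (m := m) (lam := lam) (η := η) (i := i) a₁ a (measurable_logRatio i j a)
      (hI.memLp_logRatio i j a)
  filter_upwards [h1, h2] with ω h1 h2 j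
  have h3 : ∀ a, Tendsto (fun n : ℕ => (n : ℝ)⁻¹ * ∑ l ∈ Finset.range n,
      m.actionInd a₁ a (l + 1) ω * m.logRatio i j a ((ω (l + 1)).2.2.1 a)) atTop
      (𝓝 ((lam i a).toReal * m.drift i j a)) := by
    intro a
    have h4 := (h2 j a).add ((((h1 a).1.const_mul (η : ℝ)).add
      ((h1 a).2.const_mul (1 - η : ℝ))).const_mul (m.drift i j a))
    have h5 : 0 + m.drift i j a * ((η : ℝ) * (lam i a).toReal + (1 - η) * (lam i a).toReal) =
        (lam i a).toReal * m.drift i j a := by ring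
    rw [h5] at h4
    refine h4.congr fun n => ?_
    rw [drift]
    ring
  have h6 := ((tendsto_inv_atTop_nhds_zero_nat (𝕜 := ℝ)).mul_const (m.gap i j a₁ 0 ω)).add
    (tendsto_finsetSum Finset.univ fun a _ => h3 a)
  rw [zero_mul, zero_add] at h6
  refine h6.congr fun n => ?_
  rw [gap_eq_sum i j a₁ n ω, mul_add, Finset.mul_sum]

end Frequencies

end Model
end ASHT

namespace ASHT

/-! ### Deterministic asymptotics of hitting times -/

section HittingTime

/-- The first time `n + 1` such that `R n` holds. -/
noncomputable def hittingTime (R : ℕ → Prop) : ℝ≥0∞ :=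
  ((⨅ (n : ℕ) (_ : R n), ((n + 1 : ℕ) : ℕ∞) : ℕ∞) : ℝ≥0∞)

theorem hittingTime_le {R : ℕ → Prop} {n : ℕ} (h : R n) : hittingTime R ≤ n + 1 := by
  have h1 : (⨅ (n : ℕ) (_ : R n), ((n + 1 : ℕ) : ℕ∞)) ≤ ((n + 1 : ℕ) : ℕ∞) := iInf₂_le n h
  have h2 := ENat.toENNReal_mono h1
  simpa [hittingTime] using h2

theorem le_hittingTime {R : ℕ → Prop} {x : ℝ≥0∞} (h : ∀ n, R n → x ≤ n + 1) :
    x ≤ hittingTime R := by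
  simp only [hittingTime, ENat.toENNReal_iInf]
  exact le_iInf₂ fun n hn => by simpa using h n hn

open Classical in
theorem hittingTime_eq_iInf (R : ℕ → Prop) :
    hittingTime R = ⨅ n : ℕ, if R n then (n + 1 : ℝ≥0∞) else ∞ := by
  refine le_antisymm (le_iInf fun n => ?_) (le_hittingTime fun n hn => ?_)
  · split_ifs with h
    · exact hittingTime_le h
    · exact le_top
  · exact (iInf_le _ n).trans (by simp [hn])

theorem measurable_hittingTime {Ω : Type*} [MeasurableSpace Ω] {R : Ω → ℕ → Prop}
    (hR : ∀ n, MeasurableSet {ω | R ω n}) : Measurable fun ω => hittingTime (R ω) := by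
  classical
  simp_rw [hittingTime_eq_iInf]
  exact Measurable.iInf fun n => Measurable.ite (hR n) measurable_const measurable_const

/-- If there are `k` bad indices in all, then one of the `k + 1` indices `N, …, N + k` is not bad.
-/
theorem hittingTime_le_add_tsum {R B : ℕ → Prop} [DecidablePred B] {N : ℕ}
    (h : ∀ n, N ≤ n → ¬ B n → R n) :
    hittingTime R ≤ N + 1 + ∑' n, if B n then (1 : ℝ≥0∞) else 0 := by
  set W := ∑' n, if B n then (1 : ℝ≥0∞) else 0 with hW
  by_cases hWt : W = ∞
  · simp [hWt]
  obtain ⟨k, hk⟩ : ∃ k : ℕ, k = ⌊W.toReal⌋₊ := ⟨_, rfl⟩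
  have hk1 : (k : ℝ≥0∞) ≤ W := by
    rw [← ENNReal.ofReal_toReal hWt, ← ENNReal.ofReal_natCast, hk]
    exact ENNReal.ofReal_le_ofReal (Nat.floor_le ENNReal.toReal_nonneg)
  have hk2 : W < (k + 1 : ℕ) := by
    rw [← ENNReal.ofReal_toReal hWt, ← ENNReal.ofReal_natCast, hk]
    refine (ENNReal.ofReal_lt_ofReal_iff (by positivity)).2 ?_
    push_cast
    exact Nat.lt_floor_add_one _
  obtain ⟨n, hn, hBn⟩ : ∃ n ∈ Finset.Ico N (N + (k + 1)), ¬ B n := by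
    by_contra! hcon
    have h1 : ∑ n ∈ Finset.Ico N (N + (k + 1)), (if B n then (1 : ℝ≥0∞) else 0) ≤ W :=
      ENNReal.sum_le_tsum _
    rw [Finset.sum_congr rfl fun n hn => if_pos (hcon n hn)] at h1
    simp only [Finset.sum_const, Nat.card_Ico, add_tsub_cancel_left, nsmul_eq_mul, mul_one] at h1
    exact absurd hk2 (not_lt.2 h1)
  rw [Finset.mem_Ico] at hn
  calc hittingTime R ≤ n + 1 := hittingTime_le (h n hn.1 hBn)
    _ ≤ (N + k : ℕ) + 1 := by
        gcongr
        omega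
    _ = N + 1 + k := by
        push_cast
        ring
    _ ≤ N + 1 + W := by gcongr

/-- Inversion of linear growth: if level `c` is reached at index `n` roughly when `c ≤ D n`, then it
is first reached near `c / D`. `h2` excludes hits much earlier and `h3` forces one not much later;
`h1` prevents the finitely many small indices from being hits at high levels. -/
theorem tendsto_hittingTime_div {R : ℝ → ℕ → Prop} {D : ℝ} (hD : 0 < D)
    (h1 : ∀ n, ∃ B : ℝ, ∀ c, R c n → c ≤ B)
    (h2 : ∀ ε > 0, ∀ᶠ n : ℕ in atTop, ∀ c, R c n → c ≤ (D + ε) * n)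
    (h3 : ∀ ε > 0, ∀ᶠ n : ℕ in atTop, ∀ c, c ≤ (D - ε) * n → R c n) :
    Tendsto (fun c => hittingTime (R c) / ENNReal.ofReal c) atTop (𝓝 (ENNReal.ofReal (1 / D))) := by
  refine tendsto_order.2 ⟨fun x hx => ?_, fun x hx => ?_⟩
  · have hlim : Tendsto (fun ε : ℝ => ENNReal.ofReal (1 / (D + ε))) (𝓝[>] 0)
        (𝓝 (ENNReal.ofReal (1 / (D + 0)))) := by
      refine ENNReal.tendsto_ofReal (tendsto_const_nhds.div ?_ (by simpa using hD.ne'))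
      exact tendsto_const_nhds.add (tendsto_id.mono_left nhdsWithin_le_nhds)
    rw [add_zero] at hlim
    obtain ⟨ε, hε, hεpos⟩ :=
      ((hlim.eventually (lt_mem_nhds hx)).and self_mem_nhdsWithin).exists
    have hεpos : 0 < ε := hεpos
    obtain ⟨N, hN⟩ := eventually_atTop.1 (h2 ε hεpos)
    choose B hB using h1
    set C := ∑ n ∈ Finset.range N, |B n| with hC
    have hC0 : 0 ≤ C := Finset.sum_nonneg fun _ _ => abs_nonneg _
    have hbd : ∀ c n, R c n → c ≤ C + (D + ε) * n := by
      intro c n hR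
      by_cases hn : N ≤ n
      · linarith [hN n hn c hR]
      · have h5 : |B n| ≤ C := Finset.single_le_sum (f := fun n => |B n|)
          (fun _ _ => abs_nonneg _) (Finset.mem_range.2 (not_le.1 hn))
        have h6 : 0 ≤ (D + ε) * n := by positivity
        linarith [hB n c hR, le_abs_self (B n)]
    have hlim2 : Tendsto (fun c : ℝ => ENNReal.ofReal ((1 - C / c) / (D + ε))) atTop
        (𝓝 (ENNReal.ofReal ((1 - 0) / (D + ε)))) :=
      ENNReal.tendsto_ofReal ((tendsto_const_nhds.sub
        (tendsto_const_nhds.div_atTop tendsto_id)).div_const _)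
    rw [sub_zero] at hlim2
    filter_upwards [hlim2.eventually (lt_mem_nhds hε), eventually_gt_atTop 0] with c hc hc0
    refine hc.trans_le ?_
    rw [ENNReal.le_div_iff_mul_le (Or.inl (ENNReal.ofReal_pos.2 hc0).ne')
      (Or.inl ENNReal.ofReal_ne_top), ← ENNReal.ofReal_mul' hc0.le]
    refine le_hittingTime fun n hR => ?_
    have h7 : (n : ℝ≥0∞) + 1 = ENNReal.ofReal ((n : ℝ) + 1) := by
      rw [ENNReal.ofReal_add (by positivity) zero_le_one]
      simp
    rw [h7]
    refine ENNReal.ofReal_le_ofReal ?_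
    have h8 : (1 - C / c) / (D + ε) * c = (c - C) / (D + ε) := by
      field_simp
    rw [h8, div_le_iff₀ (by positivity)]
    nlinarith [hbd c n hR]
  · have hlim : Tendsto (fun ε : ℝ => ENNReal.ofReal (1 / (D - ε))) (𝓝[>] 0)
        (𝓝 (ENNReal.ofReal (1 / (D - 0)))) := by
      refine ENNReal.tendsto_ofReal (tendsto_const_nhds.div ?_ (by simpa using hD.ne'))
      exact tendsto_const_nhds.sub (tendsto_id.mono_left nhdsWithin_le_nhds)
    rw [sub_zero] at hlim
    have hlt : ∀ᶠ ε : ℝ in 𝓝[>] 0, ε < D := nhdsWithin_le_nhds (gt_mem_nhds hD)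
    obtain ⟨ε, ⟨hε, hεpos⟩, hεD⟩ :=
      (((hlim.eventually (gt_mem_nhds hx)).and self_mem_nhdsWithin).and hlt).exists
    have hεpos : 0 < ε := hεpos
    have hDε : 0 < D - ε := sub_pos.2 hεD
    obtain ⟨N, hN⟩ := eventually_atTop.1 (h3 ε hεpos)
    -- In `N + 2`, one unit pays for the ceiling and one for the shift between the index `n` and the
    -- time `n + 1`.
    have hlim2 : Tendsto (fun c : ℝ => ENNReal.ofReal (1 / (D - ε) + (N + 2) / c)) atTop
        (𝓝 (ENNReal.ofReal (1 / (D - ε) + 0))) :=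
      ENNReal.tendsto_ofReal (tendsto_const_nhds.add (tendsto_const_nhds.div_atTop tendsto_id))
    rw [add_zero] at hlim2
    filter_upwards [hlim2.eventually (gt_mem_nhds hε), eventually_gt_atTop 0] with c hc hc0
    refine lt_of_le_of_lt ?_ hc
    rw [ENNReal.div_le_iff (ENNReal.ofReal_pos.2 hc0).ne' ENNReal.ofReal_ne_top,
      ← ENNReal.ofReal_mul' hc0.le]
    set n := N + ⌈c / (D - ε)⌉₊ with hn
    have hR : R c n := by
      refine hN n (Nat.le_add_right _ _) c ?_
      rw [← div_le_iff₀' hDε]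
      refine (Nat.le_ceil _).trans ?_
      rw [hn]
      push_cast
      linarith [(Nat.cast_nonneg N : (0 : ℝ) ≤ N)]
    refine (hittingTime_le hR).trans ?_
    have h7 : (n : ℝ≥0∞) + 1 = ENNReal.ofReal ((n : ℝ) + 1) := by
      rw [ENNReal.ofReal_add (by positivity) zero_le_one]
      simp
    rw [h7]
    refine ENNReal.ofReal_le_ofReal ?_
    have h8 : (1 / (D - ε) + (N + 2) / c) * c = c / (D - ε) + (N + 2) := by
      field_simp
    rw [h8, hn]
    push_cast
    linarith [Nat.ceil_lt_add_one (div_nonneg hc0.le hDε.le)]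

end HittingTime

end ASHT

namespace ASHT
namespace Model

variable {M : ℕ} {𝒜 𝒳 : Type*} [MeasurableSpace 𝒳] {m : Model M 𝒜 𝒳}

/-! ### The rate as the smallest drift -/

section Rate

variable [Fintype 𝒜] {lam : Fin M → PMF 𝒜} {i : Fin M}

theorem AssumptionI.sum_mul_relEnt (hI : m.AssumptionI) (p : PMF 𝒜) (i j : Fin M) :
    ∑ a, p a * m.relEnt i j a = ENNReal.ofReal (∑ a, (p a).toReal * m.drift i j a) := by
  rw [ENNReal.ofReal_sum_of_nonneg fun a _ =>
    mul_nonneg ENNReal.toReal_nonneg (hI.drift_nonneg i j a)]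
  refine Finset.sum_congr rfl fun a _ => ?_
  rw [ENNReal.ofReal_mul ENNReal.toReal_nonneg, ENNReal.ofReal_toReal (PMF.apply_ne_top _ _),
    hI.relEnt_eq]

/-- The rate `D_i` is the smallest mean drift of the gaps under `λ_i`, and it is positive. -/
theorem exists_rate_eq [Nat.AtLeastTwo M] (hlam : m.IsOptimal lam) (hI : m.AssumptionI)
    (hIIb : m.AssumptionIIb lam) (i : Fin M) : ∃ j₀, j₀ ≠ i ∧
      m.rate i = ENNReal.ofReal (∑ a, (lam i a).toReal * m.drift i j₀ a) ∧
      0 < ∑ a, (lam i a).toReal * m.drift i j₀ a ∧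
      ∀ j, j ≠ i → ∑ a, (lam i a).toReal * m.drift i j₀ a ≤
        ∑ a, (lam i a).toReal * m.drift i j a := by
  classical
  have : Nontrivial (Fin M) := Fin.nontrivial_iff_two_le.2 Nat.AtLeastTwo.prop
  obtain ⟨j₁, hj₁⟩ := exists_ne i
  obtain ⟨j₀, hj₀, hmin⟩ := Finset.exists_min_image (Finset.univ.filter (· ≠ i))
    (fun j => ∑ a, (lam i a).toReal * m.drift i j a) ⟨j₁, by simpa using hj₁⟩
  have hj₀' : j₀ ≠ i := (Finset.mem_filter.1 hj₀).2
  have hmin' : ∀ j, j ≠ i → ∑ a, (lam i a).toReal * m.drift i j₀ a ≤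
      ∑ a, (lam i a).toReal * m.drift i j a := fun j hj => hmin j (by simpa using hj)
  refine ⟨j₀, hj₀', ?_, ?_, hmin'⟩
  · have hrate : m.rate i = m.guard i (lam i) :=
      le_antisymm (iSup_le (hlam i)) (le_iSup (m.guard i) (lam i))
    rw [hrate, guard]
    simp_rw [hI.sum_mul_relEnt]
    exact le_antisymm (iInf₂_le j₀ hj₀')
      (le_iInf₂ fun j hj => ENNReal.ofReal_le_ofReal (hmin' j hj))
  · obtain ⟨a, ha, hla⟩ := hIIb.exists_pos hj₀'.symm i
    rw [← ENNReal.ofReal_pos, ← hI.sum_mul_relEnt]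
    exact (ENNReal.mul_pos hla.ne' ha.ne').trans_le
      (Finset.single_le_sum (f := fun a => lam i a * m.relEnt i j₀ a) (fun _ _ => zero_le)
        (Finset.mem_univ a))

end Rate

/-! ### Asymptotics of the stopping time -/

section StoppingTime

variable [Nat.AtLeastTwo M]

/-- Retirement, with the parameter `L` written as `exp c`. -/
def RetiresAt (m : Model M 𝒜 𝒳) (a₁ : 𝒜) (ω : ℕ → Noise M 𝒜 𝒳) (c : ℝ) (n : ℕ) : Prop :=
  ∀ j, j ≠ (m.run (a₁, ω) n).leader → Real.log ((M : ℝ) - 1) + c ≤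
    (m.run (a₁, ω) n).Z (m.run (a₁, ω) n).leader - (m.run (a₁, ω) n).Z j

theorem one_le_cast_sub_one : (1 : ℝ) ≤ (M : ℝ) - 1 := by
  have : ((2 : ℕ) : ℝ) ≤ M := Nat.cast_le.2 Nat.AtLeastTwo.prop
  push_cast at this
  linarith

theorem stoppingTime_eq_hittingTime (a₁ : 𝒜) (ω : ℕ → Noise M 𝒜 𝒳) {L : ℝ} (hL : 0 < L) :
    ((m.stoppingTime L (a₁, ω) : ℕ∞) : ℝ≥0∞) = hittingTime (m.RetiresAt a₁ ω (Real.log L)) := by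
  have hM := one_le_cast_sub_one (M := M)
  have h : m.RetiresAt a₁ ω (Real.log L) = fun n => (m.run (a₁, ω) n).Retires L := by
    funext n
    rw [RetiresAt, State.Retires, Real.log_mul (by linarith) hL.ne']
  rw [h]
  rfl

/-- Once `i` leads, retirement is decided by the smallest gap, which grows at rate `d j₀`: the gap
to `j₀` bounds the reachable level from above, and all other gaps grow at least as fast. -/
theorem tendsto_hittingTime_retiresAt {a₁ : 𝒜} {ω : ℕ → Noise M 𝒜 𝒳} {i j₀ : Fin M}
    {d : Fin M → ℝ} (hj₀ : j₀ ≠ i) (hd0 : 0 < d j₀) (hd : ∀ j, j ≠ i → d j₀ ≤ d j)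
    (hleader : ∀ᶠ n in atTop, (m.run (a₁, ω) n).leader = i)
    (hgap : ∀ j, Tendsto (fun n : ℕ => (n : ℝ)⁻¹ * m.gap i j a₁ n ω) atTop (𝓝 (d j))) :
    Tendsto (fun c => hittingTime (m.RetiresAt a₁ ω c) / ENNReal.ofReal c) atTop
      (𝓝 (ENNReal.ofReal (1 / d j₀))) := by
  have hlog : 0 ≤ Real.log ((M : ℝ) - 1) := Real.log_nonneg one_le_cast_sub_one
  refine tendsto_hittingTime_div hd0 (fun n => ?_) (fun ε hε => ?_) (fun ε hε => ?_)
  · have : Nontrivial (Fin M) := Fin.nontrivial_iff_two_le.2 Nat.AtLeastTwo.prop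
    obtain ⟨j, hj⟩ := exists_ne (m.run (a₁, ω) n).leader
    exact ⟨_, fun c hc => le_trans (by linarith) (hc j hj)⟩
  · filter_upwards [hleader, (hgap j₀).eventually (gt_mem_nhds (lt_add_of_pos_right _ hε)),
      eventually_gt_atTop 0] with n h1 h2 h3 c hc
    have h4 : (0 : ℝ) < n := Nat.cast_pos.2 h3
    have h5 := hc j₀ (by rwa [h1])
    rw [h1] at h5
    have h6 : m.gap i j₀ a₁ n ω < (d j₀ + ε) * n := by
      rwa [inv_mul_lt_iff₀ h4, mul_comm] at h2
    rw [gap] at h6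
    linarith
  · have h1 : ∀ᶠ n : ℕ in atTop, ∀ j, j ≠ i → d j₀ - ε / 2 < (n : ℝ)⁻¹ * m.gap i j a₁ n ω := by
      refine eventually_all.2 fun j => ?_
      by_cases hj : j = i
      · simp [hj]
      · filter_upwards [(hgap j).eventually (lt_mem_nhds (show d j₀ - ε / 2 < d j by
          linarith [hd j hj]))] with n hn _ using hn
    -- Half of `ε` absorbs the constant `log (M - 1)`, the other half the fluctuations of the gaps.
    have h2 : ∀ᶠ n : ℕ in atTop, Real.log ((M : ℝ) - 1) ≤ ε / 2 * n :=
      (tendsto_natCast_atTop_atTop.const_mul_atTop (half_pos hε)).eventually_ge_atTop _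
    filter_upwards [hleader, h1, h2, eventually_gt_atTop 0] with n h3 h4 h5 h6 c hc j hj
    rw [h3] at hj ⊢
    have h7 : (0 : ℝ) < n := Nat.cast_pos.2 h6
    have h8 : (d j₀ - ε / 2) * n < m.gap i j a₁ n ω := by
      have := h4 j hj
      rwa [lt_inv_mul_iff₀ h7, mul_comm] at this
    rw [gap] at h8
    linarith

open Classical in
-- This is the dominating function, uniform in `c ≥ 1`. From index `b / κ` on, a time at which all
-- gaps exceed `κ n` is a time of retirement, so the delay is at most the number of exceptional
-- times.
theorem hittingTime_retiresAt_div_le {a₁ : 𝒜} {ω : ℕ → Noise M 𝒜 𝒳} {i : Fin M} {κ c : ℝ}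
    (hκ : 0 < κ) (hc : 1 ≤ c)
    (hleader : ∀ n, (m.run (a₁, ω) n).leader ∈ argmax (m.run (a₁, ω) n).Z) :
    hittingTime (m.RetiresAt a₁ ω c) / ENNReal.ofReal c ≤
      ENNReal.ofReal ((Real.log ((M : ℝ) - 1) + 1) / κ + 2) +
        ∑' n : ℕ, if ∃ j, j ≠ i ∧ m.gap i j a₁ n ω < κ * n then (1 : ℝ≥0∞) else 0 := by
  have hlog : 0 ≤ Real.log ((M : ℝ) - 1) := Real.log_nonneg one_le_cast_sub_one
  have hc0 : 0 < c := zero_lt_one.trans_le hc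
  set b := Real.log ((M : ℝ) - 1) + c with hb
  have hb0 : 0 < b := by linarith
  have h1 : hittingTime (m.RetiresAt a₁ ω c) ≤ (⌈b / κ⌉₊ : ℕ) + 1 +
      ∑' n : ℕ, if ∃ j, j ≠ i ∧ m.gap i j a₁ n ω < κ * n then (1 : ℝ≥0∞) else 0 := by
    refine hittingTime_le_add_tsum fun n hn hB => ?_
    push Not at hB
    have h2 : b ≤ κ * n := by
      rw [← div_le_iff₀' hκ]
      exact (Nat.le_ceil _).trans (Nat.cast_le.2 hn)
    have h3 : (m.run (a₁, ω) n).leader = i :=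
      leader_eq_of_gap_pos (hleader n) fun j hj => by linarith [hB j hj]
    intro j hj
    rw [h3] at hj ⊢
    exact h2.trans (hB j hj)
  have hc1 : 1 ≤ ENNReal.ofReal c := by simpa using hc
  refine (ENNReal.div_le_div_right h1 _).trans ?_
  rw [ENNReal.add_div]
  refine add_le_add ?_ (ENNReal.div_le_of_le_mul (le_mul_of_one_le_right' hc1))
  have h4 : ((⌈b / κ⌉₊ : ℕ) : ℝ≥0∞) + 1 = ENNReal.ofReal (⌈b / κ⌉₊ + 1) := by
    rw [ENNReal.ofReal_add (by positivity) zero_le_one]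
    simp
  rw [h4, ← ENNReal.ofReal_div_of_pos hc0]
  refine ENNReal.ofReal_le_ofReal ?_
  rw [div_le_iff₀ hc0]
  have h5 := Nat.ceil_lt_add_one (div_nonneg hb0.le hκ.le)
  -- Since `c ≥ 1`, `log (M - 1) + c ≤ (log (M - 1) + 1) * c`.
  have h6 : b / κ ≤ (Real.log ((M : ℝ) - 1) + 1) / κ * c := by
    rw [div_mul_eq_mul_div]
    gcongr
    nlinarith
  nlinarith

variable [Fintype 𝒜] [MeasurableSpace 𝒜] [MeasurableSingletonClass 𝒜]
  {lam : Fin M → PMF 𝒜} {η : unitInterval}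

theorem measurable_hittingTime_retiresAt (a₁ : 𝒜) (c : ℝ) :
    Measurable fun ω => hittingTime (m.RetiresAt a₁ ω c) := by
  refine measurable_hittingTime fun n => ?_
  have hl := measurable_of_piLE (measurable_run (m := m) a₁ n).2.2
  have hZ := measurable_of_piLE (measurable_run (m := m) a₁ n).2.1
  have h1 : Measurable fun p : Fin M × (Fin M → ℝ) => p.2 p.1 :=
    measurable_from_prod_countable_right fun k => measurable_pi_apply k
  simp only [RetiresAt]
  rw [Set.ofPred_forall]
  refine MeasurableSet.iInter fun j => ?_
  refine MeasurableSet.imp ?_ ?_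
  · exact (hl (measurableSet_singleton j).compl).congr (by ext; simp [eq_comm])
  · exact measurableSet_le measurable_const
      ((h1.comp (hl.prodMk hZ)).sub ((measurable_pi_apply j).comp hZ))

/-- Dominated convergence: the almost sure limit is the constant `1 / D_i`, and the number of
exceptional times has as its mean the finite sum of their probabilities. -/
theorem tendsto_lintegral_hittingTime_div (hlam : m.IsOptimal lam) (hI : m.AssumptionI)
    (hIIb : m.AssumptionIIb lam) (hη : 0 < η) (i : Fin M) (a₁ : 𝒜) :
    Tendsto (fun c : ℝ => (∫⁻ ω, hittingTime (m.RetiresAt a₁ ω c) ∂(m.noiseSeqLaw lam η i)) /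
      ENNReal.ofReal c) atTop (𝓝 (1 / m.rate i)) := by
  classical
  obtain ⟨j₀, hj₀, hrate, hpos, hmin⟩ := exists_rate_eq hlam hI hIIb i
  obtain ⟨κ, hκ, hsum⟩ := exists_linear_lower_bound hI hIIb hη i a₁
  rw [hrate, ← ENNReal.ofReal_one, ← ENNReal.ofReal_div_of_pos hpos]
  have hBm : ∀ n : ℕ, MeasurableSet {ω | ∃ j, j ≠ i ∧ m.gap i j a₁ n ω < κ * n} := by
    intro n
    rw [Set.ofPred_exists]
    refine MeasurableSet.iUnion fun j => (MeasurableSet.const _).inter ?_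
    exact measurableSet_lt (measurable_of_piLE (measurable_gap i j a₁ n)) measurable_const
  have hBm' : ∀ n : ℕ, Measurable fun ω =>
      if ∃ j, j ≠ i ∧ m.gap i j a₁ n ω < κ * n then (1 : ℝ≥0∞) else 0 :=
    fun n => Measurable.ite (hBm n) measurable_const measurable_const
  have h := tendsto_lintegral_filter_of_dominated_convergence
    (μ := m.noiseSeqLaw lam η i) (l := atTop)
    (F := fun c ω => hittingTime (m.RetiresAt a₁ ω c) / ENNReal.ofReal c)
    (f := fun _ => ENNReal.ofReal (1 / ∑ a, (lam i a).toReal * m.drift i j₀ a))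
    (fun ω => ENNReal.ofReal ((Real.log ((M : ℝ) - 1) + 1) / κ + 2) +
        ∑' n : ℕ, if ∃ j, j ≠ i ∧ m.gap i j a₁ n ω < κ * n then (1 : ℝ≥0∞) else 0)
    (Eventually.of_forall fun c => (measurable_hittingTime_retiresAt a₁ c).div_const _) ?_ ?_ ?_
  · rw [lintegral_const, measure_univ, mul_one] at h
    refine h.congr fun c => ?_
    simp_rw [div_eq_mul_inv]
    rw [lintegral_mul_const _ (measurable_hittingTime_retiresAt a₁ c)]
  · filter_upwards [eventually_ge_atTop 1] with c hc
    filter_upwards [ae_leader_mem_argmax (m := m) (lam := lam) (η := η) (i := i) a₁] with ω hω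
    exact hittingTime_retiresAt_div_le hκ hc hω
  · rw [lintegral_add_left measurable_const, lintegral_const, measure_univ, mul_one,
      lintegral_tsum fun n => (hBm' n).aemeasurable]
    refine ENNReal.add_ne_top.2 ⟨ENNReal.ofReal_ne_top, ?_⟩
    convert hsum using 3 with n
    rw [← lintegral_indicator_one (hBm n)]
    refine lintegral_congr fun ω => ?_
    simp [Set.indicator_apply]
  · filter_upwards [ae_eventually_leader_eq hI hIIb hη i a₁,
      ae_tendsto_gap_div hI hIIb hη i a₁] with ω h1 h2
    exact tendsto_hittingTime_retiresAt (d := fun j => ∑ a, (lam i a).toReal * m.drift i j a)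
      hj₀ hpos hmin h1 h2

theorem expectedStoppingTime_eq_sum (ν : PMF 𝒜) (i : Fin M) {L : ℝ} (hL : 0 < L) :
    m.expectedStoppingTime lam η ν L i = ∑ a, ν a *
      ∫⁻ ω, hittingTime (m.RetiresAt a ω (Real.log L)) ∂(m.noiseSeqLaw lam η i) := by
  have hm : Measurable fun ω : Sample M 𝒜 𝒳 => ((m.stoppingTime L ω : ℕ∞) : ℝ≥0∞) := by
    refine measurable_from_prod_countable_right fun a => ?_
    simp_rw [stoppingTime_eq_hittingTime a _ hL]
    exact measurable_hittingTime_retiresAt a _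
  rw [expectedStoppingTime, law, lintegral_prod _ hm.aemeasurable, lintegral_fintype]
  refine Finset.sum_congr rfl fun a _ => ?_
  rw [PMF.toMeasure_apply_singleton _ _ (measurableSet_singleton a), mul_comm]
  simp_rw [stoppingTime_eq_hittingTime a _ hL]
  rfl

end StoppingTime

end Model
end ASHT

theorem mainTheorem2 {M : ℕ} [Nat.AtLeastTwo M] {𝒜 𝒳 : Type*} [Fintype 𝒜] [MeasurableSpace 𝒜]
    [MeasurableSingletonClass 𝒜] [MeasurableSpace 𝒳] (m : ASHT.Model M 𝒜 𝒳)
    (lam : Fin M → PMF 𝒜) (hlam : m.IsOptimal lam)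
    (hI : m.AssumptionI) (hIIb : m.AssumptionIIb lam)
    (η : unitInterval) (hη : 0 < η) (ν : PMF 𝒜) (i : Fin M) :
    ∃ ℓ : ℝ≥0∞,
      Tendsto (fun L : ℝ => m.expectedStoppingTime lam η ν L i / ENNReal.ofReal (Real.log L))
        atTop (𝓝 ℓ) ∧ ℓ ≤ 1 / m.rate i := by
  -- The bound is attained. The limit is the same for every first action, so averaging over `ν`
  -- leaves it unchanged.
  refine ⟨1 / m.rate i, ?_, le_rfl⟩
  have h := tendsto_finsetSum Finset.univ fun a _ => ENNReal.Tendsto.const_mul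
    ((ASHT.Model.tendsto_lintegral_hittingTime_div hlam hI hIIb hη i a).comp
      Real.tendsto_log_atTop) (Or.inr (PMF.apply_ne_top ν a))
  have hsum : ∑ a, ν a = 1 := by
    rw [← tsum_fintype (L := .unconditional _), PMF.tsum_coe]
  rw [← Finset.sum_mul, hsum, one_mul] at h
  refine h.congr' ?_
  filter_upwards [eventually_gt_atTop 0] with L hL
  rw [ASHT.Model.expectedStoppingTime_eq_sum ν i hL]
  simp_rw [div_eq_mul_inv, Finset.sum_mul, Function.comp_apply, mul_assoc]
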